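/- Let $m\in\mathbb N\cup\{0\}$. For a smooth regular plane curve $\gamma$ defined on $[-1,1]$ let $s$ be arclength, $\tau=\gamma_s$ the unit tangent, $\nu$ the rotation of $\tau$ by $+\pi/2$, $k=\langle\gamma_{ss},\nu\rangle$ the curvature, and $k_{s^\ell}$ the $\ell$-th arclength derivative of $k$. For $d_0>0$ let $\eta_-,\eta_+$ be vertical lines in the plane, $\eta_+$ lying at distance $d_0$ to the right of $\eta_-$. We say that $\gamma$ satisfies the generalised Neumann boundary conditions if $\gamma(\pm1)\in\eta_\pm$, $\gamma$ is orthogonal to $\eta_\pm$ at $\gamma(\pm1)$, and $k_{s^{2i+1}}=0$ at $\pm1$ for $i=0,\dots,m$. There is $\varepsilon>0$ depending only on $m$ such that the following holds for every $\ell\in\mathbb N\cup\{0\}$. Let $\gamma_0:[-1,1]\to\mathbb R^2$ be a smooth immersed curve satisfying the generalised Neumann boundary conditions, with winding number $\omega=\frac1{2\pi}\int_{\gamma_0}\kappa\,ds=0$ and $$L_0\int_{\gamma_0}\kappa^2\,ds\le\varepsilon ,$$ where $\kappa$ and $L_0$ are the curvature and the length of $\gamma_0$. Let $0<T\le\infty$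 and let $\gamma:[-1,1]\times[0,T)\to\mathbb R^2$ be a smooth family of regular curves, satisfying the generalised Neumann boundary conditions at every time, with $\gamma(\cdot,0)=\gamma_0$ and $$\frac{\partial\gamma}{\partial t}=(-1)^{m+1}k_{s^{2m+2}}\,\nu .$$ Then $$\int_{\gamma(\cdot,t)}k_{s^\ell}^2\,ds\le C_{m,\ell}\qquad\text{for all }t\in[0,T),$$ where the constant $C_{m,\ell}$ depends only on $m$, $\ell$, $L_0$ and the initial value $\int_{\gamma_0}\kappa_{s^\ell}^2\,ds$ (in particular not on $t$ or $T$). -/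

import Mathlib

open scoped ContDiff

noncomputable section

namespace PolyharmonicFlow

/-- The Euclidean plane. -/
abbrev Plane : Type := EuclideanSpace ℝ (Fin 2)

/-- The parameter interval `[-1, 1]` of all curves. -/
abbrev Param : Set ℝ := Set.Icc (-1) 1

/-- The length element `|c'|` of a curve `c` (one-sided derivatives at `±1`). -/
def speed (c : ℝ → Plane) (x : ℝ) : ℝ := ‖derivWithin c Param x‖

/-- Arclength derivative along `c`: `f_s = |c'|⁻¹ f'`. -/
def arcDeriv {E : Type*} [NormedAddCommGroup E] [NormedSpace ℝ E]
    (c : ℝ → Plane) (f : ℝ → E) (x : ℝ) : E :=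
  (speed c x)⁻¹ • derivWithin f Param x

/-- The unit tangent `c_s`. -/
def tangent (c : ℝ → Plane) : ℝ → Plane := arcDeriv c c

/-- The unit normal: the tangent rotated by `π / 2` counterclockwise. -/
def normal (c : ℝ → Plane) (x : ℝ) : Plane := !₂[-(tangent c x 1), tangent c x 0]

/-- The signed curvature `k = ⟨c_ss, ν⟩`. -/
def curvature (c : ℝ → Plane) (x : ℝ) : ℝ :=
  inner ℝ (arcDeriv c (tangent c) x) (normal c x)

/-- `k_{s^n}`, the `n`-th iterated arclength derivative of the curvature. -/
def curvatureDeriv (c : ℝ → Plane) (n : ℕ) : ℝ → ℝ := (arcDeriv c)^[n] (curvature c)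

/-- The integral `∫ f ds` along `c`. -/
def arcIntegral (c : ℝ → Plane) (f : ℝ → ℝ) : ℝ := ∫ x in (-1 : ℝ)..1, f x * speed c x

/-- The length of `c`. -/
def length (c : ℝ → Plane) : ℝ := arcIntegral c fun _ => 1

/-- `ω = (2π)⁻¹ ∫ k ds`. -/
def windingNumber (c : ℝ → Plane) : ℝ := (2 * Real.pi)⁻¹ * arcIntegral c (curvature c)

/-- `∫ k_{s^n}² ds`. -/
def curvatureEnergy (c : ℝ → Plane) (n : ℕ) : ℝ :=
  arcIntegral c fun x => curvatureDeriv c n x ^ 2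

/-- A smooth immersed curve on `[-1, 1]`. -/
structure IsSmoothImmersed (c : ℝ → Plane) : Prop where
  smooth : ContDiffOn ℝ ∞ c Param
  regular : ∀ x ∈ Param, derivWithin c Param x ≠ 0

/-- The `m + 2` generalised Neumann boundary conditions at the vertical lines
`η₋ = {x₀ = a}` and `η₊ = {x₀ = a + d}`: the curve has its end points on these lines, meets
them orthogonally, and `k_s, k_{s^3}, …, k_{s^{2m+1}}` vanish at both end points. -/
structure HasNeumannBoundary (m : ℕ) (a d : ℝ) (c : ℝ → Plane) : Prop where
  left_mem : c (-1) 0 = a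
  right_mem : c 1 0 = a + d
  left_orthogonal : tangent c (-1) 1 = 0
  right_orthogonal : tangent c 1 1 = 0
  left_odd : ∀ i ≤ m, curvatureDeriv c (2 * i + 1) (-1) = 0
  right_odd : ∀ i ≤ m, curvatureDeriv c (2 * i + 1) 1 = 0

/-- The time interval `[0, T)`, where `T` may be infinite. -/
def timeInterval (T : EReal) : Set ℝ := {t | 0 ≤ t ∧ (t : EReal) < T}

/-- `γ x t` is a smooth regular solution on `[-1, 1] × [0, T)` of
`∂γ/∂t = (-1)^{m+1} k_{s^{2m+2}} ν` with the generalised Neumann boundary conditions and with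
initial curve `γ₀`. -/
structure IsPolyharmonicFlow (m : ℕ) (a d : ℝ) (γ₀ : ℝ → Plane) (T : EReal)
    (γ : ℝ → ℝ → Plane) : Prop where
  smooth : ContDiffOn ℝ ∞ (fun p : ℝ × ℝ => γ p.1 p.2) (Param ×ˢ timeInterval T)
  regular : ∀ t ∈ timeInterval T, ∀ x ∈ Param, derivWithin (fun y => γ y t) Param x ≠ 0
  initial : ∀ x ∈ Param, γ x 0 = γ₀ x
  evolution : ∀ t ∈ timeInterval T, ∀ x ∈ Param,
    derivWithin (γ x) (timeInterval T) t =
      ((-1) ^ (m + 1) * curvatureDeriv (fun y => γ y t) (2 * m + 2) x) •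
        normal (fun y => γ y t) x
  boundary : ∀ t ∈ timeInterval T, HasNeumannBoundary m a d fun y => γ y t

end PolyharmonicFlow

end

noncomputable section

namespace PolyharmonicFlow

open MeasureTheory Set

/-! Write $E_n=\int k_{s^n}^2\,ds$ and $N=n+m+2$. Along the flow $E_n'=-2E_N+\int k_{s^n}P\,ds$,
where $P$ is cubic in the $k_{s^i}$ with $n+2m+2$ derivatives in all (`hasDerivAt_energy`). Every
integration by parts is free of boundary terms, because all odd derivatives of $k$ vanish at the end
points (`famCurv_eq_zero_of_odd`).

The integral of $k$ stays zero, so each $k_{s^i}$ has a zero. This gives $\sup k_{s^i}^4\le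
4E_iE_{i+1}$ (`sq_sq_le`) and the Poincaré inequality $E_i\le 4L^2E_{i+1}$ (`energy_le`).
Integration by parts also gives log-convexity, $E_{i+1}^2\le E_iE_{i+2}$. With $q$ defined by
$E_N=E_0q^{2N}$ it follows that $E_i\le E_0q^{2i}$ for $i\le N$. Interpolation thus becomes counting
powers of $q$: the quartic integral is at most a constant times $E_0^2q^{2N-1}$ (`quartic_le`), and
`young_ratio` splits this into $E_N$ plus a multiple of $E_0^{2N+1}$. Hence $E_n'\le
-E_N+CE_0^{2N+1}$.

The length does not increase, so Poincaré bounds $E_N$ below by $(4L_0^2)^{-(m+2)}E_n$, and a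
barrier argument closes the estimate (`energy_le_of_deriv_le`). For $n=0$ the barrier
$2\varepsilon/L_0$ works by scaling when $\varepsilon$ is small in terms of $m$. With $E_0$
controlled, the forcing for $n=\ell$ is a constant, and a second barrier bounds $E_\ell$ with the
same $\varepsilon$. -/

/-- The integral `∫ f v` over the parameter interval, with a weight `v`. -/
def wint (v f : ℝ → ℝ) : ℝ := ∫ x in (-1 : ℝ)..1, f x * v x

/-- A weight `v` and a sequence of functions, each the derivative of the previous one with respect
to `v dx`, such that the odd ones vanish at the end points and the first one has mean zero. -/
structure ArcJet (v : ℝ → ℝ) (u : ℕ → ℝ → ℝ) : Prop where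
  cont : ContinuousOn v Param
  pos : ∀ x ∈ Param, 0 < v x
  deriv : ∀ n, ∀ x ∈ Param, HasDerivWithinAt (u n) (v x * u (n + 1) x) Param x
  left : ∀ n, Odd n → u n (-1) = 0
  right : ∀ n, Odd n → u n 1 = 0
  mean : wint v (u 0) = 0

theorem uIcc_param : uIcc (-1 : ℝ) 1 = Param := uIcc_of_le (by norm_num)

theorem intervalIntegrable_of_continuousOn_param {f : ℝ → ℝ} (hf : ContinuousOn f Param) :
    IntervalIntegrable f volume (-1) 1 :=
  ContinuousOn.intervalIntegrable (by rwa [uIcc_param])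

/-! ### Integrals against a positive weight. -/

section Weighted

variable {v f g : ℝ → ℝ}

theorem wint_mono (hv : ContinuousOn v Param) (hpos : ∀ x ∈ Param, 0 < v x)
    (hf : ContinuousOn f Param) (hg : ContinuousOn g Param) (h : ∀ x ∈ Param, f x ≤ g x) :
    wint v f ≤ wint v g :=
  intervalIntegral.integral_mono_on (by norm_num)
    (intervalIntegrable_of_continuousOn_param (hf.mul hv))
    (intervalIntegrable_of_continuousOn_param (hg.mul hv))
    fun x hx => mul_le_mul_of_nonneg_right (h x hx) (hpos x hx).le

theorem wint_nonneg (hpos : ∀ x ∈ Param, 0 < v x) (h : ∀ x ∈ Param, 0 ≤ f x) : 0 ≤ wint v f :=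
  intervalIntegral.integral_nonneg (by norm_num) fun x hx => mul_nonneg (h x hx) (hpos x hx).le

theorem wint_add (hv : ContinuousOn v Param)
    (hf : ContinuousOn f Param) (hg : ContinuousOn g Param) :
    wint v (fun x => f x + g x) = wint v f + wint v g := by
  unfold wint
  simp only [add_mul]
  exact intervalIntegral.integral_add (intervalIntegrable_of_continuousOn_param (hf.mul hv))
    (intervalIntegrable_of_continuousOn_param (hg.mul hv))

theorem wint_const_mul (r : ℝ) : wint v (fun x => r * f x) = r * wint v f := by
  unfold wint
  rw [← intervalIntegral.integral_const_mul]
  simp only [mul_assoc]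

theorem wint_congr (h : ∀ x ∈ Param, f x = g x) : wint v f = wint v g :=
  intervalIntegral.integral_congr fun x hx => by
    rw [uIcc_param] at hx
    simp only [h x hx]

/-- Cauchy–Schwarz, from the discriminant of the nonnegative quadratic $r\mapsto\int(f+rg)^2v$. -/
theorem sq_wint_mul_le (hv : ContinuousOn v Param) (hpos : ∀ x ∈ Param, 0 < v x)
    (hf : ContinuousOn f Param) (hg : ContinuousOn g Param) :
    wint v (fun x => f x * g x) ^ 2 ≤
      wint v (fun x => f x ^ 2) * wint v (fun x => g x ^ 2) := by
  have key : ∀ r : ℝ, 0 ≤ wint v (fun x => g x ^ 2) * (r * r) +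
      (2 * wint v (fun x => f x * g x)) * r + wint v (fun x => f x ^ 2) := by
    intro r
    have h0 : 0 ≤ wint v (fun x => (r * r) * g x ^ 2 + ((2 * r) * (f x * g x) + f x ^ 2)) :=
      wint_nonneg hpos fun x _ => by nlinarith [sq_nonneg (f x + r * g x)]
    rw [wint_add hv (by fun_prop) (by fun_prop), wint_add hv (by fun_prop) (by fun_prop),
      wint_const_mul, wint_const_mul] at h0
    linarith
  have := discrim_le_zero key
  unfold discrim at this
  nlinarith

theorem wint_deriv_eq_zero (hv : ContinuousOn v Param) (hg : ContinuousOn g Param)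
    (h : ∀ x ∈ Param, HasDerivWithinAt f (v x * g x) Param x)
    (hl : f (-1) = 0) (hr : f 1 = 0) : wint v g = 0 := by
  have h1 : ∫ x in (-1 : ℝ)..1, v x * g x = f 1 - f (-1) :=
    intervalIntegral.integral_eq_sub_of_hasDeriv_right_of_le (by norm_num)
      (fun x hx => (h x hx).continuousWithinAt)
      (fun x hx => ((h x (Ioo_subset_Icc_self hx)).hasDerivAt
        (Icc_mem_nhds hx.1 hx.2)).hasDerivWithinAt)
      (intervalIntegrable_of_continuousOn_param (hv.mul hg))
  rw [hl, hr, sub_zero] at h1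
  rw [← h1]
  simp only [wint, mul_comm]

/-- A continuous function without zeros has one sign on the connected interval, so its weighted
integral is nonzero. -/
theorem exists_zero_of_wint_eq_zero (hv : ContinuousOn v Param) (hpos : ∀ x ∈ Param, 0 < v x)
    (hf : ContinuousOn f Param) (h : wint v f = 0) : ∃ x ∈ Param, f x = 0 := by
  by_contra! hne
  have hlt : (-1 : ℝ) < 1 := by norm_num
  have hconn : IsPreconnected (f '' Param) := isPreconnected_Icc.image f hf
  have h1 : (-1 : ℝ) ∈ Param := by constructor <;> norm_num
  have h0 : (0 : ℝ) ∉ f '' Param := by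
    rintro ⟨x, hx, hx0⟩
    exact hne x hx hx0
  have hord := hconn.ordConnected
  rcases lt_or_gt_of_ne (hne _ h1) with hneg | hps
  · have hall : ∀ x ∈ Param, f x < 0 := fun x hx => by
      by_contra! hx0
      exact h0 (hord.out (mem_image_of_mem f h1) (mem_image_of_mem f hx) ⟨hneg.le, hx0⟩)
    have : 0 < ∫ x in (-1 : ℝ)..1, -(f x * v x) :=
      intervalIntegral.intervalIntegral_pos_of_pos_on
        (intervalIntegrable_of_continuousOn_param (hf.mul hv).neg)
        (fun x hx => by
          have hx' := Ioo_subset_Icc_self hx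
          nlinarith [mul_pos_of_neg_of_neg (hall x hx') (neg_lt_zero.2 (hpos x hx'))]) hlt
    rw [intervalIntegral.integral_neg] at this
    unfold wint at h
    linarith
  · have hall : ∀ x ∈ Param, 0 < f x := fun x hx => by
      by_contra! hx0
      exact h0 (hord.out (mem_image_of_mem f hx) (mem_image_of_mem f h1) ⟨hx0, hps.le⟩)
    have : 0 < ∫ x in (-1 : ℝ)..1, f x * v x :=
      intervalIntegral.intervalIntegral_pos_of_pos_on
        (intervalIntegrable_of_continuousOn_param (hf.mul hv))
        (fun x hx => mul_pos (hall x (Ioo_subset_Icc_self hx)) (hpos x (Ioo_subset_Icc_self hx))) hlt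
    unfold wint at h
    linarith

end Weighted

/-- If a positive sequence is log-convex and takes the same value at both ends of `[0, N]`, it is
bounded by that value in between. -/
theorem le_of_logConvex {B : ℕ → ℝ} {N : ℕ} (hpos : ∀ i, 0 < B i)
    (hB : ∀ i, B (i + 1) ^ 2 ≤ B i * B (i + 2)) (hN : B N = B 0) : ∀ i ≤ N, B i ≤ B 0 := by
  by_contra! hcon
  obtain ⟨i, hi, hlt⟩ := hcon
  obtain ⟨j, hj, hmax⟩ := Finset.exists_max_image (Finset.range (N + 1)) B ⟨0, by simp⟩
  have hgt : ∃ j, j ≤ N ∧ B 0 < B j ∧ ∀ l ≤ N, B l ≤ B j :=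
    ⟨j, by simpa [Nat.lt_succ_iff] using hj,
      hlt.trans_le (hmax i (by simpa [Nat.lt_succ_iff] using hi)),
      fun l hl => hmax l (by simpa [Nat.lt_succ_iff] using hl)⟩
  classical
  -- At the first index that attains a maximum above `B 0`, which is interior, the left neighbour is
  -- strictly smaller and the right one no larger. Their product is then less than the square of the
  -- maximum, against log-convexity.
  obtain ⟨hfN, hf0, hfmax⟩ := Nat.find_spec hgt
  have hmin : ∀ l, l < Nat.find hgt → B l < B (Nat.find hgt) := by
    intro l hl
    by_contra! hle
    exact Nat.find_min hgt hl
      ⟨hl.le.trans hfN, hf0.trans_le hle, fun p hp => (hfmax p hp).trans hle⟩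
  generalize Nat.find hgt = p at *
  rcases p with _ | p
  · exact lt_irrefl _ hf0
  · have hne : p + 1 ≠ N := fun h => by rw [h, hN] at hf0; exact lt_irrefl _ hf0
    have h1 := hmin p (by omega)
    have h2 := hfmax (p + 2) (by omega)
    have h3 := hB p
    nlinarith [hpos p, hpos (p + 1), hpos (p + 2), mul_pos (hpos p) (hpos (p + 2)),
      mul_le_mul_of_nonneg_left h2 (hpos p).le, mul_lt_mul_of_pos_right h1 (hpos (p + 1))]

/-! ### Interpolation inequalities for the arclength derivatives. -/

namespace ArcJet

variable {v : ℝ → ℝ} {u : ℕ → ℝ → ℝ}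

/-- The energy `∫ u_n² v`. -/
abbrev energy (v : ℝ → ℝ) (u : ℕ → ℝ → ℝ) (n : ℕ) : ℝ := wint v fun x => u n x ^ 2

theorem continuousOn (h : ArcJet v u) (n : ℕ) : ContinuousOn (u n) Param :=
  fun x hx => (h.deriv n x hx).continuousWithinAt

theorem energy_nonneg (h : ArcJet v u) (n : ℕ) : 0 ≤ energy v u n :=
  wint_nonneg h.pos fun _ _ => sq_nonneg _

/-- The boundary term $u_au_b$ vanishes: when $a+b$ is odd, one of the two indices is odd. -/
theorem wint_mul_succ (h : ArcJet v u) {a b : ℕ} (hab : Odd (a + b)) :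
    wint v (fun x => u a x * u (b + 1) x) = -wint v (fun x => u (a + 1) x * u b x) := by
  have ca := h.continuousOn a
  have ca' := h.continuousOn (a + 1)
  have cb := h.continuousOn b
  have cb' := h.continuousOn (b + 1)
  have hend : ∀ y : ℝ, (∀ n, Odd n → u n y = 0) → u a y * u b y = 0 := by
    intro y hy
    rcases Nat.even_or_odd a with ha | ha
    · rw [hy b ((Nat.odd_add'.1 hab).2 ha), mul_zero]
    · rw [hy a ha, zero_mul]
  have := wint_deriv_eq_zero (f := fun x => u a x * u b x)
    (g := fun x => u (a + 1) x * u b x + u a x * u (b + 1) x) h.cont (by fun_prop)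
    (fun x hx => ((h.deriv a x hx).mul (h.deriv b x hx)).congr_deriv (by ring))
    (hend _ h.left) (hend _ h.right)
  rw [wint_add h.cont (by fun_prop) (by fun_prop)] at this
  linarith

/-- Move $p$ derivatives from the right factor to the left. The boundary products always have
indices summing to $2n-1$, so the parity condition holds at each step. -/
theorem wint_mul_add (h : ArcJet v u) (n : ℕ) : ∀ p a : ℕ, n = a + p →
    wint v (fun x => u a x * u (n + p) x) = (-1) ^ p * energy v u n := by
  intro p
  induction p with
  | zero =>
    rintro a rfl
    simp [energy, sq]
  | succ p ih =>
    rintro a rfl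
    have h1 := h.wint_mul_succ (a := a) (b := a + (p + 1) + p) (by
      rw [show a + (a + (p + 1) + p) = 2 * (a + p) + 1 by ring]; exact odd_two_mul_add_one _)
    rw [show a + (p + 1) + (p + 1) = a + (p + 1) + p + 1 by ring, h1, ih (a + 1) (by ring)]
    ring

theorem energy_succ_sq_le (h : ArcJet v u) (i : ℕ) :
    energy v u (i + 1) ^ 2 ≤ energy v u i * energy v u (i + 2) := by
  have h1 := h.wint_mul_succ (a := i) (b := i + 1) (by
    rw [show i + (i + 1) = 2 * i + 1 by ring]; exact odd_two_mul_add_one _)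
  have h2 := sq_wint_mul_le h.cont h.pos (h.continuousOn i) (h.continuousOn (i + 2))
  rw [h1, neg_sq] at h2
  simpa [energy, sq] using h2

/-- For odd $i$ the end points serve. For even $i$ the function has mean zero: by hypothesis if
$i=0$, and otherwise as the derivative of an odd-index function vanishing at both ends. -/
theorem exists_zero (h : ArcJet v u) (i : ℕ) : ∃ x ∈ Param, u i x = 0 := by
  rcases Nat.even_or_odd i with hi | hi
  · refine exists_zero_of_wint_eq_zero h.cont h.pos (h.continuousOn i) ?_
    rcases i with _ | i
    · exact h.mean
    · have hi' : Odd i := by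
        rcases Nat.even_or_odd i with h' | h'
        · exact absurd hi (Nat.not_even_iff_odd.2 h'.add_one)
        · exact h'
      exact wint_deriv_eq_zero h.cont (h.continuousOn _) (h.deriv i) (h.left i hi') (h.right i hi')
  · exact ⟨-1, by constructor <;> norm_num, h.left i hi⟩

/-- Integrate $(u_i^2)_s=2u_iu_{i+1}$ from a zero of $u_i$, enlarge the domain to the whole
interval, and apply Cauchy–Schwarz. -/
theorem sq_sq_le (h : ArcJet v u) (i : ℕ) {x : ℝ} (hx : x ∈ Param) :
    (u i x ^ 2) ^ 2 ≤ 4 * (energy v u i * energy v u (i + 1)) := by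
  obtain ⟨y, hy, hy0⟩ := h.exists_zero i
  have ci := h.continuousOn i
  have ci' := h.continuousOn (i + 1)
  have cv := h.cont
  have hsub : uIcc y x ⊆ Param := (ordConnected_Icc).uIcc_subset hy hx
  have hcont : ContinuousOn (fun z => 2 * (u i z * u (i + 1) z * v z)) Param := by fun_prop
  have h1 : ∫ z in y..x, 2 * (u i z * u (i + 1) z * v z) = u i x ^ 2 - u i y ^ 2 := by
    refine intervalIntegral.integral_eq_sub_of_hasDeriv_right
      (f := fun z => u i z ^ 2) ((ci.pow 2).mono hsub) ?_ (hcont.mono hsub).intervalIntegrable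
    intro z hz
    have hz' : z ∈ Ioo (-1 : ℝ) 1 :=
      ⟨(le_min hy.1 hx.1).trans_lt hz.1, hz.2.trans_le (max_le hy.2 hx.2)⟩
    refine HasDerivAt.hasDerivWithinAt ?_
    have := (h.deriv i z (Ioo_subset_Icc_self hz')).hasDerivAt (Icc_mem_nhds hz'.1 hz'.2)
    exact (this.pow 2).congr_deriv (by push_cast; ring)
  have h2 : u i x ^ 2 ≤ 2 * wint v (fun z => |u i z| * |u (i + 1) z|) := by
    have habs : ContinuousOn (fun z => 2 * (|u i z| * |u (i + 1) z| * v z)) Param := by fun_prop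
    have e1 : u i x ^ 2 = ∫ z in y..x, 2 * (u i z * u (i + 1) z * v z) := by rw [h1, hy0]; ring
    have e2 : |∫ z in y..x, 2 * (u i z * u (i + 1) z * v z)| ≤
        ∫ z in (-1 : ℝ)..1, 2 * (|u i z| * |u (i + 1) z| * v z) := by
      have e3 := intervalIntegral.norm_integral_le_integral_norm_uIoc (μ := volume)
        (f := fun z => 2 * (u i z * u (i + 1) z * v z)) (a := y) (b := x)
      rw [Real.norm_eq_abs] at e3
      refine e3.trans ?_
      rw [intervalIntegral.integral_of_le (by norm_num : (-1 : ℝ) ≤ 1)]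
      have hsub' : uIoc y x ⊆ Ioc (-1 : ℝ) 1 := fun z hz =>
        ⟨(le_min hy.1 hx.1).trans_lt hz.1, hz.2.trans (max_le hy.2 hx.2)⟩
      have hint : IntegrableOn (fun z => 2 * (|u i z| * |u (i + 1) z| * v z)) (Ioc (-1 : ℝ) 1) :=
        (habs.integrableOn_Icc).mono_set Ioc_subset_Icc_self
      calc ∫ z in uIoc y x, ‖2 * (u i z * u (i + 1) z * v z)‖
          = ∫ z in uIoc y x, 2 * (|u i z| * |u (i + 1) z| * v z) := by
            refine setIntegral_congr_fun measurableSet_uIoc fun z hz => ?_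
            have := h.pos z (Ioc_subset_Icc_self (hsub' hz))
            simp [abs_of_pos this]
        _ ≤ _ := by
            refine setIntegral_mono_set hint ?_ hsub'.eventuallyLE
            refine (ae_restrict_iff' measurableSet_Ioc).2 (Filter.Eventually.of_forall ?_)
            intro z hz
            have := (h.pos z (Ioc_subset_Icc_self hz)).le
            exact mul_nonneg zero_le_two (mul_nonneg (by positivity) this)
    rw [intervalIntegral.integral_const_mul (r := 2) (f := fun z => |u i z| * |u (i + 1) z| * v z)]
      at e2
    exact e1.le.trans ((le_abs_self _).trans e2)
  have h3 := sq_wint_mul_le h.cont h.pos ci.abs ci'.abs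
  simp only [sq_abs] at h3
  have h4 : (u i x ^ 2) ^ 2 ≤ (2 * wint v (fun z => |u i z| * |u (i + 1) z|)) ^ 2 :=
    pow_le_pow_left₀ (sq_nonneg _) h2 2
  rw [mul_pow] at h4
  linarith

/-- Integrating the pointwise bound gives $E_i\le 2L\sqrt{E_iE_{i+1}}$; square and cancel $E_i$. -/
theorem energy_le (h : ArcJet v u) (i : ℕ) :
    energy v u i ≤ 4 * wint v (fun _ => 1) ^ 2 * energy v u (i + 1) := by
  set b := 2 * Real.sqrt (energy v u i * energy v u (i + 1)) with hb
  have hb2 : b ^ 2 = 4 * (energy v u i * energy v u (i + 1)) := by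
    rw [hb, mul_pow, Real.sq_sqrt (mul_nonneg (h.energy_nonneg _) (h.energy_nonneg _))]; norm_num
  have h1 : energy v u i ≤ b * wint v (fun _ => 1) := by
    rw [← wint_const_mul]
    refine wint_mono h.cont h.pos ((h.continuousOn i).pow 2) (by fun_prop) fun x hx => ?_
    rw [mul_one]
    exact le_of_sq_le_sq (by rw [hb2]; exact h.sq_sq_le i hx) (by positivity)
  have h2 := h.energy_nonneg i
  have h3 : energy v u i ^ 2 ≤
      energy v u i * (4 * wint v (fun _ => 1) ^ 2 * energy v u (i + 1)) := by
    calc energy v u i ^ 2 ≤ (b * wint v (fun _ => 1)) ^ 2 := pow_le_pow_left₀ h2 h1 2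
      _ = _ := by rw [mul_pow, hb2]; ring
  rcases h2.eq_or_lt with h0 | h0
  · rw [← h0]
    exact mul_nonneg (by positivity) (h.energy_nonneg _)
  · rw [sq] at h3
    exact le_of_mul_le_mul_left h3 h0

theorem energy_le_pow (h : ArcJet v u) (i p : ℕ) :
    energy v u i ≤ (4 * wint v (fun _ => 1) ^ 2) ^ p * energy v u (i + p) := by
  induction p with
  | zero => simp
  | succ p ih =>
    refine ih.trans ?_
    refine (mul_le_mul_of_nonneg_left (h.energy_le (i + p)) (by positivity)).trans_eq ?_
    rw [add_assoc]
    ring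

theorem energy_eq_zero (h : ArcJet v u) (h0 : energy v u 0 = 0) : ∀ i, energy v u i = 0 := by
  intro i
  induction i with
  | zero => exact h0
  | succ i ih =>
    have := h.energy_succ_sq_le i
    rw [ih, zero_mul] at this
    exact pow_eq_zero_iff two_ne_zero |>.1 (le_antisymm this (sq_nonneg _))

/-- The number $q=(E_N/E_0)^{1/2N}$ acts as a typical frequency and replaces fractional powers of
energies by integer powers of $q$. If $E_0=0$, every energy vanishes and $q=0$ serves. -/
theorem exists_ratio (h : ArcJet v u) {N : ℕ} (hN : N ≠ 0) :
    ∃ q : ℝ, 0 ≤ q ∧ energy v u N = energy v u 0 * q ^ (2 * N) := by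
  rcases (h.energy_nonneg 0).eq_or_lt with h0 | h0
  · exact ⟨0, le_rfl, by rw [h.energy_eq_zero h0.symm N, ← h0, zero_mul]⟩
  · have hr : 0 ≤ energy v u N / energy v u 0 := div_nonneg (h.energy_nonneg _) h0.le
    refine ⟨(energy v u N / energy v u 0) ^ (((2 * N : ℕ) : ℝ)⁻¹), by positivity, ?_⟩
    rw [Real.rpow_inv_natCast_pow hr (by omega)]
    field_simp

theorem energy_le_ratio (h : ArcJet v u) {N : ℕ} {q : ℝ} (hq : 0 ≤ q)
    (hN : energy v u N = energy v u 0 * q ^ (2 * N)) {i : ℕ} (hi : i ≤ N) :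
    energy v u i ≤ energy v u 0 * q ^ (2 * i) := by
  rcases (h.energy_nonneg 0).eq_or_lt with h0 | h0
  · rw [h.energy_eq_zero h0.symm i, ← h0, zero_mul]
  -- Poincaré carries positivity of $E_0$ up to all orders. The sequence $E_i/q^{2i}$ is then
  -- positive and log-convex, with value $E_0$ at both $0$ and $N$.
  have hApos : ∀ i, 0 < energy v u i := by
    intro i
    have := h.energy_le_pow 0 i
    rw [zero_add] at this
    exact pos_of_mul_pos_right (h0.trans_le this) (by positivity)
  rcases Nat.eq_zero_or_pos N with rfl | hNpos
  · obtain rfl : i = 0 := by omega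
    simp
  have hqpos : 0 < q := by
    refine hq.lt_of_ne fun hq0 => ?_
    rw [← hq0, zero_pow (by omega), mul_zero] at hN
    exact (hApos N).ne' hN
  have key := le_of_logConvex (B := fun i => energy v u i / q ^ (2 * i)) (N := N)
    (fun i => div_pos (hApos i) (by positivity))
    (fun i => by
      rw [div_pow, div_mul_div_comm, ← pow_mul, ← pow_add,
        show 2 * (i + 1) * 2 = 2 * i + 2 * (i + 2) by ring]
      exact div_le_div_of_nonneg_right (h.energy_succ_sq_le i) (by positivity))
    (by simp only [hN]; field_simp; simp) i hi
  simp only [mul_zero, pow_zero, div_one] at key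
  rwa [div_le_iff₀ (by positivity)] at key

/-! ### Estimates for quartic integrals. -/

/-- `∫ u_a u_b u_c u_d v`. -/
abbrev quartic (v : ℝ → ℝ) (u : ℕ → ℝ → ℝ) (a b c d : ℕ) : ℝ :=
  wint v fun x => u a x * (u b x * u c x * u d x)

theorem sq_le_ratio (h : ArcJet v u) {N : ℕ} {q : ℝ} (hq : 0 ≤ q)
    (hN : energy v u N = energy v u 0 * q ^ (2 * N)) {i : ℕ} (hi : i < N) {x : ℝ}
    (hx : x ∈ Param) : u i x ^ 2 ≤ 2 * energy v u 0 * q ^ (2 * i + 1) := by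
  have h0 := h.energy_nonneg 0
  refine le_of_sq_le_sq ?_ (by positivity)
  refine (h.sq_sq_le i hx).trans ?_
  have := mul_le_mul (h.energy_le_ratio hq hN hi.le) (h.energy_le_ratio hq hN hi)
    (h.energy_nonneg _) (by positivity)
  calc _ ≤ 4 * (energy v u 0 * q ^ (2 * i) * (energy v u 0 * q ^ (2 * (i + 1)))) := by gcongr
    _ = _ := by ring

theorem wint_sq_mul_sq_le (h : ArcJet v u) {N : ℕ} {q : ℝ} (hq : 0 ≤ q)
    (hN : energy v u N = energy v u 0 * q ^ (2 * N)) {a b : ℕ} (ha : a < N) (hb : b < N) :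
    wint v (fun x => (u a x * u b x) ^ 2) ≤ 2 * energy v u 0 ^ 2 * q ^ (2 * a + 2 * b + 1) := by
  have ca := h.continuousOn a
  have cb := h.continuousOn b
  have h0 := h.energy_nonneg 0
  calc wint v (fun x => (u a x * u b x) ^ 2)
      ≤ wint v (fun x => (2 * energy v u 0 * q ^ (2 * a + 1)) * u b x ^ 2) := by
        refine wint_mono h.cont h.pos (by fun_prop) (by fun_prop) fun x hx => ?_
        rw [mul_pow]
        exact mul_le_mul_of_nonneg_right (h.sq_le_ratio hq hN ha hx) (sq_nonneg _)
    _ = (2 * energy v u 0 * q ^ (2 * a + 1)) * energy v u b := wint_const_mul _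
    _ ≤ (2 * energy v u 0 * q ^ (2 * a + 1)) * (energy v u 0 * q ^ (2 * b)) :=
        mul_le_mul_of_nonneg_left (h.energy_le_ratio hq hN hb.le) (by positivity)
    _ = _ := by ring

/-- Cauchy–Schwarz on $(u_au_b)(u_cu_d)$. The pointwise bound for $u_i$ uses $E_{i+1}$, which is
controlled only up to order $N$; hence the strict inequalities. -/
theorem quartic_le_of_lt (h : ArcJet v u) {N : ℕ} {q : ℝ} (hq : 0 ≤ q)
    (hN : energy v u N = energy v u 0 * q ^ (2 * N)) {a b c d : ℕ}
    (ha : a < N) (hb : b < N) (hc : c < N) (hd : d < N) (hsum : a + b + c + d + 2 = 2 * N) :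
    |quartic v u a b c d| ≤ 2 * (energy v u 0 ^ 2 * q ^ (2 * N - 1)) := by
  have ca := h.continuousOn a
  have cb := h.continuousOn b
  have cc := h.continuousOn c
  have cd := h.continuousOn d
  have h0 := h.energy_nonneg 0
  refine abs_le_of_sq_le_sq ?_ (by positivity)
  have e : quartic v u a b c d = wint v (fun x => (u a x * u b x) * (u c x * u d x)) :=
    wint_congr fun x _ => by ring
  rw [e]
  refine (sq_wint_mul_le h.cont h.pos (by fun_prop) (by fun_prop)).trans ?_
  refine (mul_le_mul (h.wint_sq_mul_sq_le hq hN ha hb) (h.wint_sq_mul_sq_le hq hN hc hd)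
    (wint_nonneg h.pos fun _ _ => sq_nonneg _) (by positivity)).trans_eq ?_
  have : (2 * a + 2 * b + 1) + (2 * c + 2 * d + 1) = (2 * N - 1) * 2 := by omega
  rw [mul_pow, mul_pow, ← pow_mul, ← pow_mul, ← this, pow_add]
  ring

theorem quartic_succ (h : ArcJet v u) {a b c d : ℕ} (hodd : Odd (a + b + c + d)) :
    quartic v u (a + 1) b c d =
      -(quartic v u a (b + 1) c d + quartic v u a b (c + 1) d + quartic v u a b c (d + 1)) := by
  have C := h.continuousOn
  have ca := C a
  have cb := C b
  have cc := C c
  have cd := C d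
  have ca' := C (a + 1)
  have cb' := C (b + 1)
  have cc' := C (c + 1)
  have cd' := C (d + 1)
  have hend : ∀ y : ℝ, (∀ n, Odd n → u n y = 0) → u a y * (u b y * u c y * u d y) = 0 := by
    intro y hy
    by_cases ha : Odd a
    · simp [hy a ha]
    by_cases hb : Odd b
    · simp [hy b hb]
    by_cases hc : Odd c
    · simp [hy c hc]
    by_cases hd : Odd d
    · simp [hy d hd]
    rw [Nat.not_odd_iff_even] at ha hb hc hd
    exact absurd (((ha.add hb).add hc).add hd) (Nat.not_even_iff_odd.2 hodd)
  have := wint_deriv_eq_zero (f := fun x => u a x * (u b x * u c x * u d x))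
    (g := fun x => u (a + 1) x * (u b x * u c x * u d x) + (u a x * (u (b + 1) x * u c x * u d x) +
      (u a x * (u b x * u (c + 1) x * u d x) + u a x * (u b x * u c x * u (d + 1) x))))
    h.cont (by fun_prop)
    (fun x hx => ((h.deriv a x hx).mul (((h.deriv b x hx).mul (h.deriv c x hx)).mul
      (h.deriv d x hx))).congr_deriv (by simp only [Pi.mul_apply]; ring))
    (hend _ h.left) (hend _ h.right)
  rw [wint_add h.cont (by fun_prop) (by fun_prop), wint_add h.cont (by fun_prop) (by fun_prop),
    wint_add h.cont (by fun_prop) (by fun_prop)] at this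
  simp only [quartic]
  linarith

/-- Each integration by parts lowers the large index by one and produces three terms, hence $3^n$.
Once it reaches $N-1$, the other indices sum to $N-1$ and the previous bound applies. -/
theorem quartic_le_of_ge (h : ArcJet v u) {N : ℕ} {q : ℝ} (hq : 0 ≤ q)
    (hN : energy v u N = energy v u 0 * q ^ (2 * N)) (hN0 : 0 < N) (n : ℕ) : ∀ b c d : ℕ,
    N - 1 + n + b + c + d + 2 = 2 * N →
      |quartic v u (N - 1 + n) b c d| ≤ 3 ^ n * 2 * (energy v u 0 ^ 2 * q ^ (2 * N - 1)) := by
  induction n with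
  | zero =>
    intro b c d hsum
    rw [pow_zero, one_mul]
    exact h.quartic_le_of_lt hq hN (by omega) (by omega) (by omega) (by omega) hsum
  | succ n ih =>
    intro b c d hsum
    rw [← add_assoc, h.quartic_succ (by
      rw [Nat.odd_iff]; omega), abs_neg]
    have h1 := ih (b + 1) c d (by omega)
    have h2 := ih b (c + 1) d (by omega)
    have h3 := ih b c (d + 1) (by omega)
    refine (abs_add_three _ _ _).trans ((add_le_add (add_le_add h1 h2) h3).trans_eq ?_)
    ring

theorem quartic_le (h : ArcJet v u) {N : ℕ} {q : ℝ} (hq : 0 ≤ q)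
    (hN : energy v u N = energy v u 0 * q ^ (2 * N)) {a b c d : ℕ}
    (hsum : a + b + c + d + 2 = 2 * N) :
    |quartic v u a b c d| ≤ 3 ^ N * 2 * (energy v u 0 ^ 2 * q ^ (2 * N - 1)) := by
  have main : ∀ a b c d : ℕ, a + b + c + d + 2 = 2 * N → N ≤ a →
      |quartic v u a b c d| ≤ 3 ^ N * 2 * (energy v u 0 ^ 2 * q ^ (2 * N - 1)) := by
    intro a b c d hsum ha
    have h1 := h.quartic_le_of_ge hq hN (by omega) (a - (N - 1)) b c d (by omega)
    rw [show N - 1 + (a - (N - 1)) = a by omega] at h1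
    refine h1.trans ?_
    gcongr
    · norm_num
    · omega
  by_cases ha : N ≤ a
  · exact main a b c d hsum ha
  by_cases hb : N ≤ b
  · rw [show quartic v u a b c d = quartic v u b a c d from wint_congr fun x _ => by ring]
    exact main b a c d (by omega) hb
  by_cases hc : N ≤ c
  · rw [show quartic v u a b c d = quartic v u c a b d from wint_congr fun x _ => by ring]
    exact main c a b d (by omega) hc
  by_cases hd : N ≤ d
  · rw [show quartic v u a b c d = quartic v u d a b c from wint_congr fun x _ => by ring]
    exact main d a b c (by omega) hd
  refine (h.quartic_le_of_lt hq hN (by omega) (by omega) (by omega) (by omega) hsum).trans ?_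
  have : (1 : ℝ) ≤ 3 ^ N := one_le_pow₀ (by norm_num)
  have h2 : 0 ≤ energy v u 0 ^ 2 * q ^ (2 * N - 1) := by positivity
  nlinarith

end ArcJet

/-- Either $A\le\delta q$, and one factor $A$ is traded for $\delta q$, or $q\le\delta^{-1}A$, and
all powers of $q$ are traded for powers of $A$. -/
theorem young_ratio {A q δ : ℝ} (hA : 0 ≤ A) (hq : 0 ≤ q) (hδ : 0 < δ) {N : ℕ} (hN : 0 < N) :
    A ^ 2 * q ^ (2 * N - 1) ≤ δ * (A * q ^ (2 * N)) + δ⁻¹ ^ (2 * N - 1) * A ^ (2 * N + 1) := by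
  obtain ⟨n, rfl⟩ : ∃ n, N = n + 1 := ⟨N - 1, by omega⟩
  rw [show 2 * (n + 1) - 1 = 2 * n + 1 by omega]
  rcases le_total A (δ * q) with h | h
  · have h1 : A ^ 2 * q ^ (2 * n + 1) ≤ δ * (A * q ^ (2 * (n + 1))) := by
      calc A ^ 2 * q ^ (2 * n + 1) = A * (A * q ^ (2 * n + 1)) := by ring
        _ ≤ (δ * q) * (A * q ^ (2 * n + 1)) := mul_le_mul_of_nonneg_right h (by positivity)
        _ = _ := by ring
    have h2 : 0 ≤ δ⁻¹ ^ (2 * n + 1) * A ^ (2 * (n + 1) + 1) := by positivity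
    linarith
  · have h3 : q ≤ δ⁻¹ * A := by rw [inv_mul_eq_div, le_div_iff₀ hδ]; linarith
    have h1 : A ^ 2 * q ^ (2 * n + 1) ≤ δ⁻¹ ^ (2 * n + 1) * A ^ (2 * (n + 1) + 1) := by
      calc A ^ 2 * q ^ (2 * n + 1) ≤ A ^ 2 * (δ⁻¹ * A) ^ (2 * n + 1) := by gcongr
        _ = _ := by rw [mul_pow]; ring
    have h2 : 0 ≤ δ * (A * q ^ (2 * (n + 1))) := by positivity
    linarith

end PolyharmonicFlow

/-! ### Differential polynomials in the curvature. -/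

namespace PolyharmonicFlow

open MvPolynomial

/-- The derivation of the ring of differential polynomials in one unknown, `X n ↦ X (n + 1)`. -/
def jetDeriv : Derivation ℝ (MvPolynomial ℕ ℝ) (MvPolynomial ℕ ℝ) :=
  mkDerivation ℝ fun n => X (n + 1)

@[simp] theorem jetDeriv_X (n : ℕ) : jetDeriv (X n) = X (n + 1) := mkDerivation_X _ _ _

/-- The cubic differential polynomials of weight `w`. -/
def cubicForms (w : ℕ) : Submodule ℝ (MvPolynomial ℕ ℝ) :=
  Submodule.span ℝ {P | ∃ a b c, a + b + c = w ∧ P = X a * X b * X c}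

theorem X_mul_X_mul_X_mem (a b c : ℕ) : X a * X b * X c ∈ cubicForms (a + b + c) :=
  Submodule.subset_span ⟨a, b, c, rfl, rfl⟩

theorem jetDeriv_mem {w : ℕ} {P : MvPolynomial ℕ ℝ} (hP : P ∈ cubicForms w) :
    jetDeriv P ∈ cubicForms (w + 1) := by
  induction hP using Submodule.span_induction with
  | mem P h =>
    obtain ⟨a, b, c, rfl, rfl⟩ := h
    have e : jetDeriv (X a * X b * X c) =
        X (a + 1) * X b * X c + X a * X (b + 1) * X c + X a * X b * X (c + 1) := by
      simp only [Derivation.leibniz, jetDeriv_X, smul_eq_mul]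
      ring
    rw [e]
    refine add_mem (add_mem ?_ ?_) ?_
    · convert X_mul_X_mul_X_mem (a + 1) b c using 2; ring
    · convert X_mul_X_mul_X_mem a (b + 1) c using 2; ring
    · exact X_mul_X_mul_X_mem a b (c + 1)
  | zero => simp
  | add P Q _ _ hP hQ => rw [map_add]; exact add_mem hP hQ
  | smul r P _ hP => rw [Derivation.map_smul]; exact Submodule.smul_mem _ _ hP

/-- The cubic part of the evolution equation of `k_{s^n}`. -/
def evolutionCubic (m : ℕ) : ℕ → MvPolynomial ℕ ℝ
  | 0 => (-1 : ℝ) ^ (m + 1) • (X 0 * X 0 * X (2 * m + 2))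
  | n + 1 => jetDeriv (evolutionCubic m n) +
      (-1 : ℝ) ^ (m + 1) • (X 0 * X (2 * m + 2) * X (n + 1))

theorem evolutionCubic_mem (m n : ℕ) : evolutionCubic m n ∈ cubicForms (n + 2 * m + 2) := by
  induction n with
  | zero =>
    refine Submodule.smul_mem _ _ ?_
    convert X_mul_X_mul_X_mem 0 0 (2 * m + 2) using 2; ring
  | succ n ih =>
    refine add_mem ?_ (Submodule.smul_mem _ _ ?_)
    · convert jetDeriv_mem ih using 2; ring
    · convert X_mul_X_mul_X_mem 0 (2 * m + 2) (n + 1) using 2; ring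

/-- In a monomial of odd weight at least one index is odd. Only indices up to $w$ are constrained,
so that this can be used inside a strong induction. -/
theorem eval_eq_zero_of_odd {w : ℕ} (hw : Odd w) {y : ℕ → ℝ} (hy : ∀ n ≤ w, Odd n → y n = 0)
    {P : MvPolynomial ℕ ℝ} (hP : P ∈ cubicForms w) : eval y P = 0 := by
  induction hP using Submodule.span_induction with
  | mem P h =>
    obtain ⟨a, b, c, rfl, rfl⟩ := h
    simp only [map_mul, eval_X]
    by_cases ha : Odd a
    · rw [hy a (by omega) ha]; ring
    by_cases hb : Odd b
    · rw [hy b (by omega) hb]; ring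
    have hc : Odd c := by
      rw [Nat.not_odd_iff_even] at ha hb
      exact (Nat.odd_add'.1 hw).2 (ha.add hb)
    rw [hy c (by omega) hc, mul_zero]
  | zero => simp
  | add P Q _ _ hP hQ => rw [map_add, hP, hQ, add_zero]
  | smul r P _ hP => rw [smul_eval, hP, mul_zero]

/-- Chain rule for differential polynomials. -/
theorem hasDerivWithinAt_eval {s : Set ℝ} {x r : ℝ} {u : ℕ → ℝ → ℝ}
    (h : ∀ n, HasDerivWithinAt (u n) (r * u (n + 1) x) s x) (P : MvPolynomial ℕ ℝ) :
    HasDerivWithinAt (fun y => eval (fun n => u n y) P)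
      (r * eval (fun n => u n x) (jetDeriv P)) s x := by
  induction P using MvPolynomial.induction_on with
  | C a =>
    rw [show (jetDeriv (C a) : MvPolynomial ℕ ℝ) = 0 from derivation_C _ _]
    simpa using hasDerivWithinAt_const x s a
  | add P Q hP hQ =>
    simp only [map_add, mul_add]
    exact hP.add hQ
  | mul_X P n hP =>
    simp only [map_mul, eval_X]
    refine (hP.mul (h n)).congr_deriv ?_
    simp only [Derivation.leibniz, jetDeriv_X, smul_eq_mul, map_add, map_mul, eval_X]
    ring

theorem continuousOn_eval {s : Set ℝ} {u : ℕ → ℝ → ℝ} (h : ∀ n, ContinuousOn (u n) s)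
    (P : MvPolynomial ℕ ℝ) : ContinuousOn (fun y => eval (fun n => u n y) P) s := by
  induction P using MvPolynomial.induction_on with
  | C a => simpa using continuousOn_const
  | add P Q hP hQ =>
    simp only [map_add]
    exact hP.add hQ
  | mul_X P n hP =>
    simp only [map_mul, eval_X]
    exact hP.mul (h n)

namespace ArcJet

/-- The constant depends on $P$ and $N$ but not on the weight or the jet: it is built along the
span, starting from the monomial bound. -/
theorem exists_wint_mul_eval_le {N w : ℕ} {n : ℕ} (hw : n + w + 2 = 2 * N)
    {P : MvPolynomial ℕ ℝ} (hP : P ∈ cubicForms w) :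
    ∃ C : ℝ, ∀ (v : ℝ → ℝ) (u : ℕ → ℝ → ℝ), ArcJet v u → ∀ q : ℝ, 0 ≤ q →
      energy v u N = energy v u 0 * q ^ (2 * N) →
        |wint v (fun x => u n x * eval (fun i => u i x) P)| ≤
          C * (energy v u 0 ^ 2 * q ^ (2 * N - 1)) := by
  induction hP using Submodule.span_induction with
  | mem P h =>
    obtain ⟨a, b, c, rfl, rfl⟩ := h
    refine ⟨3 ^ N * 2, fun v u h q hq hN => ?_⟩
    simp only [map_mul, eval_X]
    exact h.quartic_le hq hN (by omega)
  | zero => exact ⟨0, fun v u h q hq hN => by simp [wint]⟩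
  | add P Q _ _ hP hQ =>
    obtain ⟨C₁, h₁⟩ := hP
    obtain ⟨C₂, h₂⟩ := hQ
    refine ⟨C₁ + C₂, fun v u h q hq hN => ?_⟩
    have cP := continuousOn_eval h.continuousOn P
    have cQ := continuousOn_eval h.continuousOn Q
    have cn := h.continuousOn n
    simp only [map_add, mul_add]
    rw [wint_add (f := fun x => u n x * eval (fun i => u i x) P)
      (g := fun x => u n x * eval (fun i => u i x) Q) h.cont (cn.mul cP) (cn.mul cQ), add_mul]
    exact (abs_add_le _ _).trans (add_le_add (h₁ v u h q hq hN) (h₂ v u h q hq hN))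
  | smul r P _ hP =>
    obtain ⟨C, h₁⟩ := hP
    refine ⟨|r| * C, fun v u h q hq hN => ?_⟩
    simp only [smul_eval, mul_left_comm _ r]
    rw [wint_const_mul, abs_mul, mul_assoc]
    exact mul_le_mul_of_nonneg_left (h₁ v u h q hq hN) (abs_nonneg _)

/-- The interpolation inequality that absorbs quartic terms. -/
theorem exists_wint_mul_eval_le_energy {N w : ℕ} {n : ℕ} (hw : n + w + 2 = 2 * N)
    {P : MvPolynomial ℕ ℝ} (hP : P ∈ cubicForms w) :
    ∃ C : ℝ, 0 < C ∧ ∀ (v : ℝ → ℝ) (u : ℕ → ℝ → ℝ), ArcJet v u →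
      wint v (fun x => u n x * eval (fun i => u i x) P) ≤
        energy v u N + C * energy v u 0 ^ (2 * N + 1) := by
  obtain ⟨C, hC⟩ := exists_wint_mul_eval_le hw hP
  have hK : 0 < |C| + 1 := by positivity
  refine ⟨(|C| + 1) * (|C| + 1) ^ (2 * N - 1), by positivity, fun v u h => ?_⟩
  obtain ⟨q, hq, hN⟩ := h.exists_ratio (N := N) (by omega)
  have h1 := (le_abs_self _).trans (hC v u h q hq hN)
  -- The choice $\delta=(|C|+1)^{-1}$ makes the coefficient of $E_N$ exactly $1$, half of the
  -- dissipation $2E_N$ available later.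
  have h2 := young_ratio (h.energy_nonneg 0) hq (inv_pos.2 hK) (N := N) (by omega)
  rw [← hN, inv_inv] at h2
  have h3 : 0 ≤ energy v u 0 ^ 2 * q ^ (2 * N - 1) := by positivity
  have h4 : C * (energy v u 0 ^ 2 * q ^ (2 * N - 1)) ≤
      (|C| + 1) * (energy v u 0 ^ 2 * q ^ (2 * N - 1)) :=
    mul_le_mul_of_nonneg_right (by linarith [le_abs_self C]) h3
  have h5 := mul_le_mul_of_nonneg_left h2 hK.le
  rw [mul_add, mul_inv_cancel_left₀ hK.ne'] at h5
  linarith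

end ArcJet

end PolyharmonicFlow

/-! ### Calculus on a space-time strip, up to its boundary. -/

namespace PolyharmonicFlow

open MeasureTheory Set Filter Topology

section Strip

variable {E : Type*} [NormedAddCommGroup E] [NormedSpace ℝ E]

/-- The space-time strip `[-1, 1] × I`. -/
abbrev strip (I : Set ℝ) : Set (ℝ × ℝ) := Param ×ˢ I

/-- The space derivative on a strip. -/
def dx (f : ℝ × ℝ → E) (p : ℝ × ℝ) : E := derivWithin (fun y => f (y, p.2)) Param p.1

/-- The time derivative on a strip. -/
def dt (I : Set ℝ) (f : ℝ × ℝ → E) (p : ℝ × ℝ) : E := derivWithin (fun s => f (p.1, s)) I p.2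

theorem uniqueDiffOn_param : UniqueDiffOn ℝ Param := uniqueDiffOn_Icc (by norm_num)

variable {I : Set ℝ} {f g : ℝ × ℝ → E} {p : ℝ × ℝ}

theorem uniqueDiffOn_strip (hI : Convex ℝ I) (hI' : (interior I).Nonempty) :
    UniqueDiffOn ℝ (strip I) :=
  uniqueDiffOn_param.prod (uniqueDiffOn_convex hI hI')

theorem strip_subset_closure_interior (hI : Convex ℝ I) (hI' : (interior I).Nonempty) :
    strip I ⊆ closure (interior (strip I)) := by
  rw [((convex_Icc (-1 : ℝ) 1).prod hI).closure_interior_eq_closure_of_nonempty_interior]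
  · exact subset_closure
  · rw [interior_prod_eq, interior_Icc]
    exact Nonempty.prod ⟨0, by norm_num⟩ hI'

theorem hasDerivWithinAt_fderivWithin_left (hf : ContDiffOn ℝ ∞ f (strip I)) (hp : p ∈ strip I) :
    HasDerivWithinAt (fun y => f (y, p.2)) (fderivWithin ℝ f (strip I) p (1, 0)) Param p.1 := by
  have h1 := ((hf.differentiableOn (by simp)) p hp).hasFDerivWithinAt
  have h2 : HasDerivWithinAt (fun y : ℝ => (y, p.2)) ((1 : ℝ), (0 : ℝ)) Param p.1 :=
    (hasDerivWithinAt_id _ _).prodMk (hasDerivWithinAt_const _ _ _)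
  exact h1.comp_hasDerivWithinAt p.1 h2 (show MapsTo _ _ (strip I) from fun y hy => ⟨hy, hp.2⟩)

theorem hasDerivWithinAt_fderivWithin_right (hf : ContDiffOn ℝ ∞ f (strip I)) (hp : p ∈ strip I) :
    HasDerivWithinAt (fun s => f (p.1, s)) (fderivWithin ℝ f (strip I) p (0, 1)) I p.2 := by
  have h1 := ((hf.differentiableOn (by simp)) p hp).hasFDerivWithinAt
  have h2 : HasDerivWithinAt (fun s : ℝ => (p.1, s)) ((0 : ℝ), (1 : ℝ)) I p.2 :=
    (hasDerivWithinAt_const _ _ _).prodMk (hasDerivWithinAt_id _ _)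
  exact h1.comp_hasDerivWithinAt p.2 h2 (show MapsTo _ _ (strip I) from fun y hy => ⟨hp.1, hy⟩)

theorem dx_eq_of_hasDerivWithinAt {d : E} (hp : p ∈ strip I)
    (h : HasDerivWithinAt (fun y => f (y, p.2)) d Param p.1) : dx f p = d :=
  h.derivWithin (uniqueDiffOn_param _ hp.1)

theorem dt_eq_of_hasDerivWithinAt {d : E} (hI : Convex ℝ I) (hI' : (interior I).Nonempty)
    (hp : p ∈ strip I) (h : HasDerivWithinAt (fun s => f (p.1, s)) d I p.2) : dt I f p = d :=
  h.derivWithin (uniqueDiffOn_convex hI hI' _ hp.2)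

theorem dx_eq_fderivWithin (hf : ContDiffOn ℝ ∞ f (strip I)) (hp : p ∈ strip I) :
    dx f p = fderivWithin ℝ f (strip I) p (1, 0) :=
  dx_eq_of_hasDerivWithinAt hp (hasDerivWithinAt_fderivWithin_left hf hp)

theorem dt_eq_fderivWithin (hI : Convex ℝ I) (hI' : (interior I).Nonempty)
    (hf : ContDiffOn ℝ ∞ f (strip I)) (hp : p ∈ strip I) :
    dt I f p = fderivWithin ℝ f (strip I) p (0, 1) :=
  dt_eq_of_hasDerivWithinAt hI hI' hp (hasDerivWithinAt_fderivWithin_right hf hp)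

theorem hasDerivWithinAt_dx (hf : ContDiffOn ℝ ∞ f (strip I)) (hp : p ∈ strip I) :
    HasDerivWithinAt (fun y => f (y, p.2)) (dx f p) Param p.1 :=
  dx_eq_fderivWithin hf hp ▸ hasDerivWithinAt_fderivWithin_left hf hp

theorem hasDerivWithinAt_dt (hI : Convex ℝ I) (hI' : (interior I).Nonempty)
    (hf : ContDiffOn ℝ ∞ f (strip I)) (hp : p ∈ strip I) :
    HasDerivWithinAt (fun s => f (p.1, s)) (dt I f p) I p.2 :=
  dt_eq_fderivWithin hI hI' hf hp ▸ hasDerivWithinAt_fderivWithin_right hf hp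

theorem dx_congr (h : ∀ q ∈ strip I, f q = g q) (hp : p ∈ strip I) : dx f p = dx g p :=
  derivWithin_congr (fun y hy => h (y, p.2) ⟨hy, hp.2⟩) (h _ hp)

theorem dt_congr (h : ∀ q ∈ strip I, f q = g q) (hp : p ∈ strip I) : dt I f p = dt I g p :=
  derivWithin_congr (fun s hs => h (p.1, s) ⟨hp.1, hs⟩) (h _ hp)

theorem contDiffOn_fderivWithin_strip (hI : Convex ℝ I) (hI' : (interior I).Nonempty)
    (hf : ContDiffOn ℝ ∞ f (strip I)) :
    ContDiffOn ℝ ∞ (fderivWithin ℝ f (strip I)) (strip I) :=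
  hf.fderivWithin (uniqueDiffOn_strip hI hI') (by simp)

theorem contDiffOn_dx (hI : Convex ℝ I) (hI' : (interior I).Nonempty)
    (hf : ContDiffOn ℝ ∞ f (strip I)) : ContDiffOn ℝ ∞ (dx f) (strip I) :=
  ((contDiffOn_fderivWithin_strip hI hI' hf).clm_apply contDiffOn_const).congr
    fun _ hq => dx_eq_fderivWithin hf hq

theorem contDiffOn_dt (hI : Convex ℝ I) (hI' : (interior I).Nonempty)
    (hf : ContDiffOn ℝ ∞ f (strip I)) : ContDiffOn ℝ ∞ (dt I f) (strip I) :=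
  ((contDiffOn_fderivWithin_strip hI hI' hf).clm_apply contDiffOn_const).congr
    fun _ hq => dt_eq_fderivWithin hI hI' hf hq

/-- Symmetry of the second derivative extends to boundary points of the strip because they lie in
the closure of its interior. -/
theorem dt_dx (hI : Convex ℝ I) (hI' : (interior I).Nonempty)
    (hf : ContDiffOn ℝ ∞ f (strip I)) (hp : p ∈ strip I) :
    dt I (dx f) p = dx (dt I f) p := by
  have hsymm : IsSymmSndFDerivWithinAt ℝ f (strip I) p :=
    (hf p hp).isSymmSndFDerivWithinAt
      (by rw [minSmoothness_of_isRCLikeNormedField]; exact WithTop.coe_le_coe.2 (le_top : (2 : ℕ∞) ≤ ⊤))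
      (uniqueDiffOn_strip hI hI')
      (strip_subset_closure_interior hI hI' hp) hp
  have hd := contDiffOn_fderivWithin_strip hI hI' hf
  have huniq := uniqueDiffOn_strip hI hI' p hp
  have key : ∀ w : ℝ × ℝ, ∀ w' : ℝ × ℝ,
      fderivWithin ℝ (fun q => fderivWithin ℝ f (strip I) q w) (strip I) p w' =
        fderivWithin ℝ (fderivWithin ℝ f (strip I)) (strip I) p w' w := fun w w' => by
    have := (((hd.differentiableOn (by simp)) p hp).hasFDerivWithinAt.clm_apply
      (hasFDerivWithinAt_const w p (strip I))).fderivWithin huniq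
    rw [this]
    simp
  rw [dt_congr (g := fun q => fderivWithin ℝ f (strip I) q (1, 0))
      (fun q hq => dx_eq_fderivWithin hf hq) hp,
    dx_congr (g := fun q => fderivWithin ℝ f (strip I) q (0, 1))
      (fun q hq => dt_eq_fderivWithin hI hI' hf hq) hp,
    dt_eq_fderivWithin hI hI' (hd.clm_apply contDiffOn_const) hp,
    dx_eq_fderivWithin (hd.clm_apply contDiffOn_const) hp, key, key]
  exact hsymm _ _

end Strip

/-! ### Integrals depending on time, and the barrier principle. -/

section Integral

variable {I : Set ℝ} {f : ℝ × ℝ → ℝ}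

theorem continuousOn_slice (hf : ContinuousOn f (strip I)) {t : ℝ} (ht : t ∈ I) :
    ContinuousOn (fun x => f (x, t)) Param :=
  hf.comp (by fun_prop) fun _ hx => ⟨hx, ht⟩

theorem continuousOn_integral_slice (hf : ContinuousOn f (strip I)) :
    ContinuousOn (fun t => ∫ x in (-1 : ℝ)..1, f (x, t)) I := by
  have hle : (-1 : ℝ) ≤ 1 := by norm_num
  rw [continuousOn_iff_continuous_domRestrict]
  -- Clamping $x$ to the interval extends the integrand continuously to all real $x$ without
  -- changing the integral.
  have h1 : Continuous (Function.uncurry fun (t : I) (x : ℝ) =>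
      f (projIcc (-1) 1 hle x, (t : ℝ))) := by
    refine hf.comp_continuous (f := fun q : I × ℝ => ((projIcc (-1) 1 hle q.2 : ℝ), (q.1 : ℝ)))
      ?_ fun q => ⟨(projIcc (-1) 1 hle q.2).2, q.1.2⟩
    exact (continuous_subtype_val.comp (continuous_projIcc.comp continuous_snd)).prodMk
      (continuous_subtype_val.comp continuous_fst)
  have h2 := intervalIntegral.continuous_parametric_intervalIntegral_of_continuous' (μ := volume)
    h1 (-1) 1
  refine h2.congr fun t => intervalIntegral.integral_congr fun x hx => ?_
  rw [uIcc_param] at hx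
  simp only [projIcc_of_mem hle hx]

theorem hasDerivAt_integral_slice (hI : Convex ℝ I) (hf : ContDiffOn ℝ ∞ f (strip I)) {t : ℝ}
    (ht : t ∈ interior I) :
    HasDerivAt (fun s => ∫ x in (-1 : ℝ)..1, f (x, s))
      (∫ x in (-1 : ℝ)..1, dt I f (x, t)) t := by
  have hI' : (interior I).Nonempty := ⟨t, ht⟩
  have hle : (-1 : ℝ) ≤ 1 := by norm_num
  obtain ⟨r, hr, hrI⟩ := Metric.nhds_basis_closedBall.mem_iff.1 (mem_interior_iff_mem_nhds.1 ht)
  have hd := (contDiffOn_dt hI hI' hf).continuousOn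
  have hcomp : IsCompact (Param ×ˢ Metric.closedBall t r) :=
    isCompact_Icc.prod (isCompact_closedBall t r)
  obtain ⟨C, hC⟩ := hcomp.exists_bound_of_continuousOn (hd.mono (prod_mono_right hrI))
  have hsub : uIoc (-1 : ℝ) 1 ⊆ Param := by rw [uIoc_of_le hle]; exact Ioc_subset_Icc_self
  have hmeas : ∀ {g : ℝ → ℝ}, ContinuousOn g Param →
      AEStronglyMeasurable g (volume.restrict (uIoc (-1 : ℝ) 1)) := fun hg =>
    (hg.mono hsub).aestronglyMeasurable measurableSet_uIoc
  refine (intervalIntegral.hasDerivAt_integral_of_dominated_loc_of_deriv_le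
    (F := fun s x => f (x, s)) (F' := fun s x => dt I f (x, s)) (bound := fun _ => C)
    (Metric.ball_mem_nhds t hr) ?_ ?_ ?_ ?_ ?_ ?_).2
  · filter_upwards [mem_interior_iff_mem_nhds.1 ht] with s hs
    exact hmeas (continuousOn_slice hf.continuousOn hs)
  · exact intervalIntegrable_of_continuousOn_param
      (continuousOn_slice hf.continuousOn (interior_subset ht))
  · exact hmeas (continuousOn_slice hd (interior_subset ht))
  · exact Eventually.of_forall fun x hx s hs => hC (x, s) ⟨hsub hx, Metric.ball_subset_closedBall hs⟩
  · exact intervalIntegrable_const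
  · refine Eventually.of_forall fun x hx s hs => ?_
    have hsI : s ∈ I := hrI (Metric.ball_subset_closedBall hs)
    exact (hasDerivWithinAt_dt hI hI' hf (p := (x, s)) ⟨hsub hx, hsI⟩).hasDerivAt
      (mem_of_superset (Metric.isOpen_ball.mem_nhds hs)
        (Metric.ball_subset_closedBall.trans hrI))

end Integral

/-- A continuous function on `I ⊆ [0, ∞)` that starts below `M` and decreases whenever it equals
`M` stays below `M`. -/
theorem le_of_deriv_neg_at_barrier {I : Set ℝ} (hI : Convex ℝ I) (h0 : 0 ∈ I)
    {f f' : ℝ → ℝ} {M : ℝ} (hf : ContinuousOn f I)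
    (hf' : ∀ t ∈ interior I, HasDerivAt f (f' t) t) (hM : f 0 < M)
    (hneg : ∀ t ∈ interior I, f t = M → f' t < 0) {t : ℝ} (ht : t ∈ I) (ht0 : 0 ≤ t) :
    f t ≤ M := by
  rcases ht0.eq_or_lt with rfl | hpos
  · exact hM.le
  have hsub : Icc 0 t ⊆ I := hI.ordConnected.out h0 ht
  have hint : Ioo 0 t ⊆ interior I :=
    interior_maximal (Ioo_subset_Icc_self.trans hsub) isOpen_Ioo
  -- The derivative is known only in the interior of $I$, so the comparison starts at a small $a>0$,
  -- where continuity still gives `f a < M`.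
  have h1 : ∀ᶠ s in 𝓝[>] 0, f s < M := by
    have h2 : ContinuousWithinAt f (Ioc 0 t) 0 := (hf 0 h0).mono (Ioc_subset_Icc_self.trans hsub)
    have h3 := h2.eventually (gt_mem_nhds hM)
    rwa [nhdsWithin_Ioc_eq_nhdsGT hpos] at h3
  obtain ⟨a, haM, ha⟩ := (h1.and (Ioo_mem_nhdsGT hpos)).exists
  refine image_le_of_deriv_right_lt_deriv_boundary' (f' := f') (B := fun _ => M) (B' := fun _ => 0)
    (a := a) (b := t) (hf.mono ((Icc_subset_Icc_left ha.1.le).trans hsub)) ?_ haM.le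
    continuousOn_const (fun _ _ => hasDerivWithinAt_const _ _ _) ?_ ⟨ha.2.le, le_rfl⟩
  · exact fun x hx => (hf' x (hint ⟨ha.1.trans_le hx.1, hx.2⟩)).hasDerivWithinAt
  · exact fun x hx => hneg x (hint ⟨ha.1.trans_le hx.1, hx.2⟩)

end PolyharmonicFlow

/-! ### Geometry of families of plane curves. -/

namespace PolyharmonicFlow

open MeasureTheory Set Filter Topology

/-- Rotation of the plane by `π / 2` counterclockwise. -/
def rot : Plane →L[ℝ] Plane :=
  LinearMap.toContinuousLinearMap
    { toFun := fun w => !₂[-(w 1), w 0]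
      map_add' := fun a b => by
        ext i
        fin_cases i
        · simp; ring
        · simp
      map_smul' := fun r a => by
        ext i
        fin_cases i <;> simp }

@[simp] theorem rot_apply_zero (w : Plane) : rot w 0 = -(w 1) := rfl

@[simp] theorem rot_apply_one (w : Plane) : rot w 1 = w 0 := rfl

theorem inner_plane (a b : Plane) : inner ℝ a b = a 0 * b 0 + a 1 * b 1 := by
  simp [PiLp.inner_apply, Fin.sum_univ_two, mul_comm]

@[simp] theorem rot_rot (w : Plane) : rot (rot w) = -w := by
  ext i
  fin_cases i <;> simp

@[simp] theorem inner_self_rot (w : Plane) : inner ℝ w (rot w) = (0 : ℝ) := by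
  rw [inner_plane, rot_apply_zero, rot_apply_one]; ring

@[simp] theorem inner_rot_self (w : Plane) : inner ℝ (rot w) w = (0 : ℝ) := by
  rw [inner_plane, rot_apply_zero, rot_apply_one]; ring

theorem inner_rot_rot (a b : Plane) : inner ℝ (rot a) (rot b) = (inner ℝ a b : ℝ) := by
  simp only [inner_plane, rot_apply_zero, rot_apply_one]; ring

theorem eq_inner_smul_add_of_unit {a : Plane} (ha : inner ℝ a a = (1 : ℝ)) (w : Plane) :
    w = (inner ℝ w a : ℝ) • a + (inner ℝ w (rot a) : ℝ) • rot a := by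
  rw [inner_plane] at ha
  ext i
  fin_cases i
  · simp [inner_plane]
    linear_combination -(w 0) * ha
  · simp [inner_plane]
    linear_combination -(w 1) * ha

section Defs

variable {E : Type*} [NormedAddCommGroup E] [NormedSpace ℝ E]

/-- The length element of a family of curves. -/
def famSpeed (Γ : ℝ × ℝ → Plane) (p : ℝ × ℝ) : ℝ := ‖dx Γ p‖

/-- The arclength derivative along a family of curves. -/
def ds (Γ : ℝ × ℝ → Plane) (f : ℝ × ℝ → E) (p : ℝ × ℝ) : E := (famSpeed Γ p)⁻¹ • dx f p

/-- The unit tangent of a family of curves. -/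
def famTangent (Γ : ℝ × ℝ → Plane) : ℝ × ℝ → Plane := ds Γ Γ

/-- The unit normal of a family of curves. -/
def famNormal (Γ : ℝ × ℝ → Plane) (p : ℝ × ℝ) : Plane := rot (famTangent Γ p)

/-- The arclength derivatives of the curvature of a family of curves. -/
def famCurv (Γ : ℝ × ℝ → Plane) : ℕ → ℝ × ℝ → ℝ
  | 0 => fun p => inner ℝ (ds Γ (famTangent Γ) p) (famNormal Γ p)
  | n + 1 => ds Γ (famCurv Γ n)

end Defs

theorem curvatureDeriv_succ (c : ℝ → Plane) (n : ℕ) :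
    curvatureDeriv c (n + 1) = arcDeriv c (curvatureDeriv c n) :=
  Function.iterate_succ_apply' _ _ _

theorem famNormal_eq (Γ : ℝ × ℝ → Plane) (p : ℝ × ℝ) :
    famNormal Γ p = normal (fun y => Γ (y, p.2)) p.1 := rfl

theorem famCurv_eq (Γ : ℝ × ℝ → Plane) (n : ℕ) (p : ℝ × ℝ) :
    famCurv Γ n p = curvatureDeriv (fun y => Γ (y, p.2)) n p.1 := by
  induction n generalizing p with
  | zero => rfl
  | succ n ih =>
    rw [curvatureDeriv_succ]
    simp only [famCurv, ds, arcDeriv, dx, ih]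
    rfl

/-- A smooth family of regular curves over a time interval. -/
structure SmoothFamily (I : Set ℝ) (Γ : ℝ × ℝ → Plane) : Prop where
  convex : Convex ℝ I
  nonempty : (interior I).Nonempty
  smooth : ContDiffOn ℝ ∞ Γ (strip I)
  regular : ∀ p ∈ strip I, dx Γ p ≠ 0

namespace SmoothFamily

variable {E : Type*} [NormedAddCommGroup E] [NormedSpace ℝ E]
variable {I : Set ℝ} {Γ : ℝ × ℝ → Plane} {f g : ℝ × ℝ → E} {r : ℝ × ℝ → ℝ}
  {a b : ℝ × ℝ → Plane} {p : ℝ × ℝ}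

theorem famSpeed_pos (H : SmoothFamily I Γ) (hp : p ∈ strip I) : 0 < famSpeed Γ p :=
  norm_pos_iff.2 (H.regular p hp)

theorem contDiffOn_famSpeed (H : SmoothFamily I Γ) : ContDiffOn ℝ ∞ (famSpeed Γ) (strip I) :=
  (contDiffOn_dx H.convex H.nonempty H.smooth).norm ℝ H.regular

theorem contDiffOn_ds (H : SmoothFamily I Γ) (hf : ContDiffOn ℝ ∞ f (strip I)) :
    ContDiffOn ℝ ∞ (ds Γ f) (strip I) :=
  (H.contDiffOn_famSpeed.inv fun _ hp => (H.famSpeed_pos hp).ne').smul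
    (contDiffOn_dx H.convex H.nonempty hf)

theorem contDiffOn_famTangent (H : SmoothFamily I Γ) : ContDiffOn ℝ ∞ (famTangent Γ) (strip I) :=
  H.contDiffOn_ds H.smooth

theorem contDiffOn_famNormal (H : SmoothFamily I Γ) : ContDiffOn ℝ ∞ (famNormal Γ) (strip I) :=
  rot.contDiff.comp_contDiffOn H.contDiffOn_famTangent

theorem contDiffOn_famCurv (H : SmoothFamily I Γ) (n : ℕ) :
    ContDiffOn ℝ ∞ (famCurv Γ n) (strip I) := by
  induction n with
  | zero => exact (H.contDiffOn_ds H.contDiffOn_famTangent).inner ℝ H.contDiffOn_famNormal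
  | succ n ih => exact H.contDiffOn_ds ih

theorem dx_eq (H : SmoothFamily I Γ) (f : ℝ × ℝ → E) (hp : p ∈ strip I) :
    dx f p = famSpeed Γ p • ds Γ f p := by
  rw [ds, smul_smul, mul_inv_cancel₀ (H.famSpeed_pos hp).ne', one_smul]

theorem hasDerivWithinAt_ds (H : SmoothFamily I Γ) (hf : ContDiffOn ℝ ∞ f (strip I))
    (hp : p ∈ strip I) :
    HasDerivWithinAt (fun y => f (y, p.2)) (famSpeed Γ p • ds Γ f p) Param p.1 :=
  H.dx_eq f hp ▸ hasDerivWithinAt_dx hf hp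

theorem ds_eq_of_hasDerivWithinAt (H : SmoothFamily I Γ) {d : E} (hp : p ∈ strip I)
    (h : HasDerivWithinAt (fun y => f (y, p.2)) (famSpeed Γ p • d) Param p.1) : ds Γ f p = d := by
  rw [ds, dx_eq_of_hasDerivWithinAt hp h, smul_smul, inv_mul_cancel₀ (H.famSpeed_pos hp).ne',
    one_smul]

theorem ds_congr (h : ∀ q ∈ strip I, f q = g q) (hp : p ∈ strip I) : ds Γ f p = ds Γ g p := by
  rw [ds, dx_congr h hp, ds]

theorem hasDerivWithinAt_dt (H : SmoothFamily I Γ) (hf : ContDiffOn ℝ ∞ f (strip I))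
    (hp : p ∈ strip I) : HasDerivWithinAt (fun s => f (p.1, s)) (dt I f p) I p.2 :=
  PolyharmonicFlow.hasDerivWithinAt_dt H.convex H.nonempty hf hp

theorem dt_eq_of_hasDerivWithinAt (H : SmoothFamily I Γ) {d : E} (hp : p ∈ strip I)
    (h : HasDerivWithinAt (fun s => f (p.1, s)) d I p.2) : dt I f p = d :=
  PolyharmonicFlow.dt_eq_of_hasDerivWithinAt H.convex H.nonempty hp h

theorem ds_smul (H : SmoothFamily I Γ) (hr : ContDiffOn ℝ ∞ r (strip I))
    (hf : ContDiffOn ℝ ∞ f (strip I)) (hp : p ∈ strip I) :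
    ds Γ (fun q => r q • f q) p = r p • ds Γ f p + ds Γ r p • f p :=
  H.ds_eq_of_hasDerivWithinAt hp
    (((H.hasDerivWithinAt_ds hr hp).smul (H.hasDerivWithinAt_ds hf hp)).congr_deriv (by
      simp only [Prod.mk.eta, smul_add, smul_smul, smul_eq_mul, mul_comm]))

theorem ds_inner (H : SmoothFamily I Γ) (ha : ContDiffOn ℝ ∞ a (strip I))
    (hb : ContDiffOn ℝ ∞ b (strip I)) (hp : p ∈ strip I) :
    ds Γ (fun q => (inner ℝ (a q) (b q) : ℝ)) p =
      inner ℝ (a p) (ds Γ b p) + inner ℝ (ds Γ a p) (b p) :=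
  H.ds_eq_of_hasDerivWithinAt hp
    (((H.hasDerivWithinAt_ds ha hp).inner ℝ (H.hasDerivWithinAt_ds hb hp)).congr_deriv (by
      simp only [inner_smul_left, inner_smul_right, smul_eq_mul, mul_add, RCLike.conj_to_real]))

theorem ds_rot (H : SmoothFamily I Γ) (ha : ContDiffOn ℝ ∞ a (strip I)) (hp : p ∈ strip I) :
    ds Γ (fun q => rot (a q)) p = rot (ds Γ a p) :=
  H.ds_eq_of_hasDerivWithinAt hp (by
    rw [← map_smul]
    exact rot.hasFDerivAt.comp_hasDerivWithinAt p.1 (H.hasDerivWithinAt_ds ha hp))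

theorem dt_smul (H : SmoothFamily I Γ) (hr : ContDiffOn ℝ ∞ r (strip I))
    (hf : ContDiffOn ℝ ∞ f (strip I)) (hp : p ∈ strip I) :
    dt I (fun q => r q • f q) p = r p • dt I f p + dt I r p • f p :=
  H.dt_eq_of_hasDerivWithinAt hp ((H.hasDerivWithinAt_dt hr hp).smul (H.hasDerivWithinAt_dt hf hp))

theorem dt_inner (H : SmoothFamily I Γ) (ha : ContDiffOn ℝ ∞ a (strip I))
    (hb : ContDiffOn ℝ ∞ b (strip I)) (hp : p ∈ strip I) :
    dt I (fun q => (inner ℝ (a q) (b q) : ℝ)) p =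
      inner ℝ (a p) (dt I b p) + inner ℝ (dt I a p) (b p) :=
  H.dt_eq_of_hasDerivWithinAt hp ((H.hasDerivWithinAt_dt ha hp).inner ℝ (H.hasDerivWithinAt_dt hb hp))

theorem dt_rot (H : SmoothFamily I Γ) (ha : ContDiffOn ℝ ∞ a (strip I)) (hp : p ∈ strip I) :
    dt I (fun q => rot (a q)) p = rot (dt I a p) :=
  H.dt_eq_of_hasDerivWithinAt hp
    (rot.hasFDerivAt.comp_hasDerivWithinAt p.2 (H.hasDerivWithinAt_dt ha hp))

theorem inner_famTangent_self (H : SmoothFamily I Γ) (hp : p ∈ strip I) :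
    inner ℝ (famTangent Γ p) (famTangent Γ p) = (1 : ℝ) := by
  have h := H.famSpeed_pos hp
  rw [famTangent, ds, real_inner_smul_left, real_inner_smul_right, real_inner_self_eq_norm_sq,
    ← famSpeed]
  field_simp

/-- Differentiating $|\tau|^2=1$ removes the tangential component of $\tau_s$. -/
theorem ds_famTangent (H : SmoothFamily I Γ) (hp : p ∈ strip I) :
    ds Γ (famTangent Γ) p = famCurv Γ 0 p • famNormal Γ p := by
  have h1 : ds Γ (fun q => (inner ℝ (famTangent Γ q) (famTangent Γ q) : ℝ)) p = 0 := by
    rw [ds_congr (g := fun _ => (1 : ℝ)) (fun q hq => H.inner_famTangent_self hq) hp]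
    exact H.ds_eq_of_hasDerivWithinAt hp (by simpa using hasDerivWithinAt_const p.1 Param (1 : ℝ))
  rw [H.ds_inner H.contDiffOn_famTangent H.contDiffOn_famTangent hp,
    real_inner_comm (ds Γ (famTangent Γ) p)] at h1
  have h2 : inner ℝ (ds Γ (famTangent Γ) p) (famTangent Γ p) = (0 : ℝ) := by linarith
  have h3 := eq_inner_smul_add_of_unit (H.inner_famTangent_self hp) (ds Γ (famTangent Γ) p)
  rw [h2, zero_smul, zero_add] at h3
  exact h3

theorem ds_famNormal (H : SmoothFamily I Γ) (hp : p ∈ strip I) :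
    ds Γ (famNormal Γ) p = -(famCurv Γ 0 p • famTangent Γ p) := by
  have : ds Γ (famNormal Γ) p = rot (ds Γ (famTangent Γ) p) := H.ds_rot H.contDiffOn_famTangent hp
  rw [this, H.ds_famTangent hp, map_smul, famNormal, rot_rot, smul_neg]

/-! ### Evolution of geometric quantities under a normal speed. -/

section Evolution

variable {F : ℝ × ℝ → ℝ}

theorem ds_smul_famNormal (H : SmoothFamily I Γ) (hF : ContDiffOn ℝ ∞ F (strip I))
    (hp : p ∈ strip I) : ds Γ (fun q => F q • famNormal Γ q) p =
      ds Γ F p • famNormal Γ p - (famCurv Γ 0 p * F p) • famTangent Γ p := by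
  rw [H.ds_smul hF H.contDiffOn_famNormal hp, H.ds_famNormal hp]
  module

/-- The evolution of the length element under a normal speed `F`. -/
theorem dt_famSpeed (H : SmoothFamily I Γ) (hF : ContDiffOn ℝ ∞ F (strip I))
    (hev : ∀ q ∈ strip I, dt I Γ q = F q • famNormal Γ q) (hp : p ∈ strip I) :
    dt I (famSpeed Γ) p = -(famCurv Γ 0 p * F p) * famSpeed Γ p := by
  have hv := H.famSpeed_pos hp
  have hX := contDiffOn_dx H.convex H.nonempty H.smooth
  have h1 : dt I (fun q => (inner ℝ (dx Γ q) (dx Γ q) : ℝ)) p =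
      2 * (famSpeed Γ p * dt I (famSpeed Γ) p) := by
    rw [dt_congr (g := fun q => famSpeed Γ q • famSpeed Γ q)
      (fun q hq => by rw [real_inner_self_eq_norm_mul_norm]; rfl) hp,
      H.dt_smul H.contDiffOn_famSpeed H.contDiffOn_famSpeed hp]
    simp only [smul_eq_mul]
    ring
  have h2 : dt I (dx Γ) p = famSpeed Γ p •
      (ds Γ F p • famNormal Γ p - (famCurv Γ 0 p * F p) • famTangent Γ p) := by
    rw [dt_dx H.convex H.nonempty H.smooth hp, dx_congr hev hp, H.dx_eq _ hp,
      H.ds_smul_famNormal hF hp]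
  rw [H.dt_inner hX hX hp, real_inner_comm (dx Γ p), h2, H.dx_eq Γ hp, ← famTangent,
    real_inner_smul_left, real_inner_smul_right, inner_sub_right, real_inner_smul_right,
    real_inner_smul_right, H.inner_famTangent_self hp, famNormal, inner_self_rot] at h1
  have h3 : famSpeed Γ p * dt I (famSpeed Γ) p =
      famSpeed Γ p * (-(famCurv Γ 0 p * F p) * famSpeed Γ p) := by linarith
  exact mul_left_cancel₀ hv.ne' h3

/-- The commutator of time and arclength derivatives. -/
theorem dt_ds (H : SmoothFamily I Γ) (hF : ContDiffOn ℝ ∞ F (strip I))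
    (hev : ∀ q ∈ strip I, dt I Γ q = F q • famNormal Γ q) (hf : ContDiffOn ℝ ∞ f (strip I))
    (hp : p ∈ strip I) :
    dt I (ds Γ f) p = ds Γ (dt I f) p + (famCurv Γ 0 p * F p) • ds Γ f p := by
  have hv := H.famSpeed_pos hp
  have h1 : dt I (fun q => (famSpeed Γ q)⁻¹) p =
      (famCurv Γ 0 p * F p) * (famSpeed Γ p)⁻¹ := by
    refine H.dt_eq_of_hasDerivWithinAt hp
      (((H.hasDerivWithinAt_dt H.contDiffOn_famSpeed hp).inv hv.ne').congr_deriv ?_)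
    rw [H.dt_famSpeed hF hev hp]
    field_simp
  have h2 : dt I (ds Γ f) p =
      (famSpeed Γ p)⁻¹ • dt I (dx f) p + dt I (fun q => (famSpeed Γ q)⁻¹) p • dx f p :=
    H.dt_smul (H.contDiffOn_famSpeed.inv fun _ hq => (H.famSpeed_pos hq).ne')
      (contDiffOn_dx H.convex H.nonempty hf) hp
  rw [h2, h1, dt_dx H.convex H.nonempty hf hp, mul_smul, ← ds, ← ds]

theorem dt_famTangent (H : SmoothFamily I Γ) (hF : ContDiffOn ℝ ∞ F (strip I))
    (hev : ∀ q ∈ strip I, dt I Γ q = F q • famNormal Γ q) (hp : p ∈ strip I) :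
    dt I (famTangent Γ) p = ds Γ F p • famNormal Γ p := by
  rw [famTangent, H.dt_ds hF hev H.smooth hp, ds_congr hev hp, H.ds_smul_famNormal hF hp,
    ← famTangent]
  module

theorem dt_famNormal (H : SmoothFamily I Γ) (hF : ContDiffOn ℝ ∞ F (strip I))
    (hev : ∀ q ∈ strip I, dt I Γ q = F q • famNormal Γ q) (hp : p ∈ strip I) :
    dt I (famNormal Γ) p = -(ds Γ F p • famTangent Γ p) := by
  have : dt I (famNormal Γ) p = rot (dt I (famTangent Γ) p) := H.dt_rot H.contDiffOn_famTangent hp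
  rw [this, H.dt_famTangent hF hev hp, map_smul, famNormal, rot_rot, smul_neg]

/-- Since $\tau_s$ is normal and $\nu_t$ tangential, only $\langle\tau_{st},\nu\rangle$ contributes:
$F_{ss}$ comes from $(F_s\nu)_s$, and $k^2F$ from the commutator. -/
theorem dt_famCurv_zero (H : SmoothFamily I Γ) (hF : ContDiffOn ℝ ∞ F (strip I))
    (hev : ∀ q ∈ strip I, dt I Γ q = F q • famNormal Γ q) (hp : p ∈ strip I) :
    dt I (famCurv Γ 0) p = ds Γ (ds Γ F) p + famCurv Γ 0 p ^ 2 * F p := by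
  have hunit := H.inner_famTangent_self hp
  have hn : inner ℝ (famNormal Γ p) (famNormal Γ p) = (1 : ℝ) := by
    rw [famNormal, inner_rot_rot, hunit]
  have hnt : inner ℝ (famNormal Γ p) (famTangent Γ p) = (0 : ℝ) := inner_rot_self _
  have htn : inner ℝ (famTangent Γ p) (famNormal Γ p) = (0 : ℝ) := inner_self_rot _
  have h1 : dt I (famCurv Γ 0) p = inner ℝ (ds Γ (famTangent Γ) p) (dt I (famNormal Γ) p) +
      inner ℝ (dt I (ds Γ (famTangent Γ)) p) (famNormal Γ p) :=
    H.dt_inner (H.contDiffOn_ds H.contDiffOn_famTangent) H.contDiffOn_famNormal hp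
  rw [h1, H.dt_ds hF hev H.contDiffOn_famTangent hp, H.dt_famNormal hF hev hp,
    ds_congr (fun q hq => H.dt_famTangent hF hev hq) hp,
    H.ds_smul_famNormal (H.contDiffOn_ds hF) hp, H.ds_famTangent hp]
  simp only [inner_add_left, inner_sub_left, inner_neg_right, real_inner_smul_left,
    real_inner_smul_right, hn, hnt, htn]
  ring

end Evolution

end SmoothFamily

end PolyharmonicFlow

/-! ### The flow with Neumann boundary conditions. -/

namespace PolyharmonicFlow

open MeasureTheory Set Filter Topology

/-- A smooth solution of the polyharmonic flow with the generalised Neumann boundary conditions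
over a time interval that starts at `0`, with initial winding number `0`. -/
structure NeumannFlow (m : ℕ) (I : Set ℝ) (Γ : ℝ × ℝ → Plane) : Prop extends
    SmoothFamily I Γ where
  zero_mem : 0 ∈ I
  nonneg : ∀ t ∈ I, 0 ≤ t
  evolution : ∀ q ∈ strip I,
    dt I Γ q = ((-1) ^ (m + 1) * famCurv Γ (2 * m + 2) q) • famNormal Γ q
  orthogonal : ∀ x, x = -1 ∨ x = 1 → ∀ t ∈ I, famTangent Γ (x, t) 1 = 0
  odd : ∀ x, x = -1 ∨ x = 1 → ∀ t ∈ I, ∀ i ≤ m, famCurv Γ (2 * i + 1) (x, t) = 0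
  winding : wint (fun x => famSpeed Γ (x, 0)) (fun x => famCurv Γ 0 (x, 0)) = 0

namespace NeumannFlow

open MvPolynomial ArcJet

variable {m : ℕ} {I : Set ℝ} {Γ : ℝ × ℝ → Plane} {p : ℝ × ℝ} {t : ℝ}

theorem contDiffOn_normalSpeed (H : NeumannFlow m I Γ) :
    ContDiffOn ℝ ∞ (fun q => (-1) ^ (m + 1) * famCurv Γ (2 * m + 2) q) (strip I) :=
  contDiffOn_const.mul (H.contDiffOn_famCurv _)

theorem ds_const_mul_famCurv (H : NeumannFlow m I Γ) (r : ℝ) (n : ℕ) (hp : p ∈ strip I) :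
    ds Γ (fun q => r * famCurv Γ n q) p = r * famCurv Γ (n + 1) p := by
  refine H.ds_eq_of_hasDerivWithinAt hp
    (((H.hasDerivWithinAt_ds (H.contDiffOn_famCurv n) hp).const_mul r).congr_deriv ?_)
  simp only [smul_eq_mul, famCurv]
  ring

/-- The recursion of `evolutionCubic` is the commutator rule: differentiate the previous equation in
$s$ and add $kF\,k_{s^{n+1}}$. -/
theorem dt_famCurv (H : NeumannFlow m I Γ) (n : ℕ) (hp : p ∈ strip I) :
    dt I (famCurv Γ n) p = (-1) ^ (m + 1) * famCurv Γ (n + 2 * m + 4) p +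
      eval (fun i => famCurv Γ i p) (evolutionCubic m n) := by
  induction n generalizing p with
  | zero =>
    rw [H.dt_famCurv_zero H.contDiffOn_normalSpeed H.evolution hp,
      SmoothFamily.ds_congr (fun q hq => H.ds_const_mul_famCurv _ _ hq) hp,
      H.ds_const_mul_famCurv _ _ hp]
    simp only [evolutionCubic, smul_eval, map_mul, eval_X]
    rw [show 0 + 2 * m + 4 = 2 * m + 2 + 1 + 1 by ring]
    ring
  | succ n ih =>
    have h1 : ds Γ (dt I (famCurv Γ n)) p = (-1) ^ (m + 1) * famCurv Γ (n + 1 + 2 * m + 4) p +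
        eval (fun i => famCurv Γ i p) (jetDeriv (evolutionCubic m n)) := by
      rw [SmoothFamily.ds_congr (fun q hq => ih hq) hp]
      refine H.ds_eq_of_hasDerivWithinAt hp
        ((((H.hasDerivWithinAt_ds (H.contDiffOn_famCurv _) hp).const_mul _).add
          (hasDerivWithinAt_eval (u := fun i y => famCurv Γ i (y, p.2)) (fun i =>
            H.hasDerivWithinAt_ds (H.contDiffOn_famCurv i) hp) _)).congr_deriv ?_)
      rw [show n + 1 + 2 * m + 4 = n + 2 * m + 4 + 1 by ring]
      simp only [smul_eq_mul, famCurv, Prod.mk.eta]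
      ring
    have h2 := H.dt_ds H.contDiffOn_normalSpeed H.evolution (H.contDiffOn_famCurv n) hp
    have h3 : ds Γ (famCurv Γ n) = famCurv Γ (n + 1) := rfl
    rw [h1, h3] at h2
    rw [h2]
    simp only [evolutionCubic, map_add, smul_eval, map_mul, eval_X, smul_eq_mul]
    ring

/-- Orders up to $2m+1$ are given. Orthogonality persists in time, so the vertical part of
$\tau_t=F_s\nu$ vanishes while that of $\nu$ does not, giving order $2m+3$. Beyond that,
$k_{s^{2j+1}}=0$ for all times; its evolution equation has a cubic part of odd weight, which
vanishes by induction, so $k_{s^{2j+2m+5}}=0$. -/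
theorem famCurv_eq_zero_of_odd (H : NeumannFlow m I Γ) {x : ℝ} (hx : x = -1 ∨ x = 1) (n : ℕ) :
    Odd n → ∀ t ∈ I, famCurv Γ n (x, t) = 0 := by
  have hxP : x ∈ Param := by rcases hx with rfl | rfl <;> constructor <;> norm_num
  induction n using Nat.strong_induction_on with
  | _ n ih =>
    rintro ⟨i, rfl⟩ t ht
    have hp : ((x, t) : ℝ × ℝ) ∈ strip I := ⟨hxP, ht⟩
    rcases le_or_gt i m with him | him
    · exact H.odd x hx t ht i him
    have hsign : ((-1 : ℝ)) ^ (m + 1) ≠ 0 := pow_ne_zero _ (by norm_num)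
    rcases (Nat.succ_le_of_lt him).eq_or_lt with rfl | him'
    · have h1 := H.dt_famTangent H.contDiffOn_normalSpeed H.evolution hp
      rw [H.ds_const_mul_famCurv _ _ hp] at h1
      have h2 := H.hasDerivWithinAt_dt H.contDiffOn_famTangent hp
      have h3 := (EuclideanSpace.proj 1 : Plane →L[ℝ] ℝ).hasFDerivAt.comp_hasDerivWithinAt t h2
      have h4 : HasDerivWithinAt (fun s => famTangent Γ (x, s) 1) 0 I t :=
        (hasDerivWithinAt_const t I (0 : ℝ)).congr (fun s hs => H.orthogonal x hx s hs)
          (H.orthogonal x hx t ht)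
      have h5 := (uniqueDiffOn_convex H.convex H.nonempty t ht).eq_deriv _ h3 h4
      rw [h1] at h5
      have h6 := H.inner_famTangent_self hp
      rw [inner_plane, H.orthogonal x hx t ht, mul_zero, add_zero] at h6
      have h7 : famTangent Γ (x, t) 0 ≠ 0 := fun h => by rw [h] at h6; simp at h6
      rw [map_smul] at h5
      change _ * famTangent Γ (x, t) 0 = 0 at h5
      exact (mul_eq_zero.1 ((mul_eq_zero.1 h5).resolve_right h7)).resolve_left hsign
    · obtain ⟨j, rfl⟩ : ∃ j, i = j + m + 2 := ⟨i - (m + 2), by omega⟩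
      have hodd : ∀ k, Odd (2 * k + 1) := fun k => odd_two_mul_add_one k
      have h1 := H.dt_famCurv (2 * j + 1) hp
      have h2 : dt I (famCurv Γ (2 * j + 1)) (x, t) = 0 :=
        H.dt_eq_of_hasDerivWithinAt hp ((hasDerivWithinAt_const t I (0 : ℝ)).congr
          (fun s hs => ih _ (by omega) (hodd j) s hs) (ih _ (by omega) (hodd j) t ht))
      have h3 : eval (fun i => famCurv Γ i (x, t)) (evolutionCubic m (2 * j + 1)) = 0 :=
        eval_eq_zero_of_odd (by rw [Nat.odd_iff]; omega)
          (fun n hn hn' => ih n (by omega) hn' t ht) (evolutionCubic_mem m (2 * j + 1))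
      rw [h2, h3, add_zero] at h1
      rw [show 2 * (j + m + 2) + 1 = 2 * j + 1 + 2 * m + 4 by ring]
      exact (mul_eq_zero.1 h1.symm).resolve_left hsign

/-- The length element at time `t`. -/
abbrev spd (Γ : ℝ × ℝ → Plane) (t : ℝ) : ℝ → ℝ := fun x => famSpeed Γ (x, t)

/-- The curvature and its arclength derivatives at time `t`. -/
abbrev jet (Γ : ℝ × ℝ → Plane) (t : ℝ) : ℕ → ℝ → ℝ := fun n x => famCurv Γ n (x, t)

theorem continuousOn_spd (H : NeumannFlow m I Γ) (ht : t ∈ I) : ContinuousOn (spd Γ t) Param :=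
  continuousOn_slice H.contDiffOn_famSpeed.continuousOn ht

theorem continuousOn_wint (H : NeumannFlow m I Γ) {f : ℝ × ℝ → ℝ}
    (hf : ContDiffOn ℝ ∞ f (strip I)) :
    ContinuousOn (fun t => wint (spd Γ t) fun x => f (x, t)) I :=
  continuousOn_integral_slice (hf.mul H.contDiffOn_famSpeed).continuousOn

theorem hasDerivAt_wint (H : NeumannFlow m I Γ) {f : ℝ × ℝ → ℝ}
    (hf : ContDiffOn ℝ ∞ f (strip I)) (ht : t ∈ interior I) :
    HasDerivAt (fun t => wint (spd Γ t) fun x => f (x, t))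
      (wint (spd Γ t) fun x => dt I f (x, t) -
        famCurv Γ 0 (x, t) * ((-1) ^ (m + 1) * famCurv Γ (2 * m + 2) (x, t)) * f (x, t)) t := by
  refine (hasDerivAt_integral_slice H.convex (hf.mul H.contDiffOn_famSpeed) ht).congr_deriv ?_
  refine intervalIntegral.integral_congr fun x hx => ?_
  rw [uIcc_param] at hx
  have hp : ((x, t) : ℝ × ℝ) ∈ strip I := ⟨hx, interior_subset ht⟩
  have h1 : dt I (fun q => f q * famSpeed Γ q) (x, t) =
      f (x, t) * dt I (famSpeed Γ) (x, t) + dt I f (x, t) * famSpeed Γ (x, t) :=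
    H.dt_smul hf H.contDiffOn_famSpeed hp
  rw [H.dt_famSpeed H.contDiffOn_normalSpeed H.evolution hp] at h1
  refine h1.trans ?_
  simp only [spd]
  ring

theorem hasDerivWithinAt_jet (H : NeumannFlow m I Γ) (ht : t ∈ I) (n : ℕ) {x : ℝ}
    (hx : x ∈ Param) :
    HasDerivWithinAt (jet Γ t n) (spd Γ t x * jet Γ t (n + 1) x) Param x :=
  H.hasDerivWithinAt_ds (H.contDiffOn_famCurv n) (p := (x, t)) ⟨hx, ht⟩

theorem continuousOn_jet (H : NeumannFlow m I Γ) (ht : t ∈ I) (n : ℕ) :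
    ContinuousOn (jet Γ t n) Param :=
  fun _ hx => (H.hasDerivWithinAt_jet ht n hx).continuousWithinAt

/-- The integral of the curvature is conserved. -/
theorem wint_famCurv_zero (H : NeumannFlow m I Γ) (ht : t ∈ I) :
    wint (spd Γ t) (jet Γ t 0) = 0 := by
  have hc := H.continuousOn_wint (H.contDiffOn_famCurv 0)
  have hd : ∀ s ∈ interior I,
      HasDerivAt (fun t => wint (spd Γ t) fun x => famCurv Γ 0 (x, t)) 0 s := by
    intro s hs
    have hsI := interior_subset hs
    refine (H.hasDerivAt_wint (H.contDiffOn_famCurv 0) hs).congr_deriv ?_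
    have hodd : Odd (2 * m + 3) := by rw [Nat.odd_iff]; omega
    -- The term $k^2F$ cancels against the change of the length element. What remains is the total
    -- derivative of $\pm k_{s^{2m+3}}$, which vanishes at both ends.
    have h1 := wint_deriv_eq_zero (H.continuousOn_spd hsI) (H.continuousOn_jet hsI (2 * m + 3 + 1))
      (fun x hx => H.hasDerivWithinAt_jet hsI (2 * m + 3) hx)
      (H.famCurv_eq_zero_of_odd (Or.inl rfl) _ hodd s hsI)
      (H.famCurv_eq_zero_of_odd (Or.inr rfl) _ hodd s hsI)
    rw [wint_congr (g := fun x => (-1) ^ (m + 1) * jet Γ s (2 * m + 3 + 1) x), wint_const_mul, h1,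
      mul_zero]
    intro x hx
    rw [H.dt_famCurv 0 ⟨hx, hsI⟩]
    simp only [evolutionCubic, smul_eval, map_mul, eval_X, jet]
    rw [show 0 + 2 * m + 4 = 2 * m + 3 + 1 by ring]
    ring
  have hdiff : DifferentiableOn ℝ (fun t => wint (spd Γ t) fun x => famCurv Γ 0 (x, t))
      (interior I) := fun s hs => (hd s hs).differentiableAt.differentiableWithinAt
  have h1 := antitoneOn_of_deriv_nonpos H.convex hc hdiff (fun s hs => (hd s hs).deriv.le)
    H.zero_mem ht (H.nonneg t ht)
  have h2 := monotoneOn_of_deriv_nonneg H.convex hc hdiff (fun s hs => (hd s hs).deriv.ge)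
    H.zero_mem ht (H.nonneg t ht)
  exact (le_antisymm h1 h2).trans H.winding

theorem arcJet (H : NeumannFlow m I Γ) (ht : t ∈ I) : ArcJet (spd Γ t) (jet Γ t) where
  cont := H.continuousOn_spd ht
  pos _ hx := H.famSpeed_pos ⟨hx, ht⟩
  deriv n _ hx := H.hasDerivWithinAt_jet ht n hx
  left n hn := H.famCurv_eq_zero_of_odd (Or.inl rfl) n hn t ht
  right n hn := H.famCurv_eq_zero_of_odd (Or.inr rfl) n hn t ht
  mean := H.wint_famCurv_zero ht

/-- The length does not increase. -/
theorem length_le (H : NeumannFlow m I Γ) (ht : t ∈ I) :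
    wint (spd Γ t) (fun _ => 1) ≤ wint (spd Γ 0) (fun _ => 1) := by
  have hs1 : ContDiffOn ℝ ∞ (fun _ : ℝ × ℝ => (1 : ℝ)) (strip I) := contDiffOn_const
  have hd : ∀ s ∈ interior I, HasDerivAt (fun t => wint (spd Γ t) fun _ => 1)
      (-energy (spd Γ s) (jet Γ s) (m + 1)) s := by
    intro s hs
    have hsI := interior_subset hs
    refine (H.hasDerivAt_wint hs1 hs).congr_deriv ?_
    -- Here $L'=-\int kF\,ds$, and $m+1$ integrations by parts produce a sign that cancels the one
    -- in $F$.
    have h1 := (H.arcJet hsI).wint_mul_add (m + 1) (m + 1) 0 (by ring)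
    rw [wint_congr (g := fun x => -(-1) ^ (m + 1) * (jet Γ s 0 x * jet Γ s (m + 1 + (m + 1)) x)),
      wint_const_mul, h1]
    · have : ((-1 : ℝ) ^ (m + 1)) * (-1) ^ (m + 1) = 1 := by
        rw [← mul_pow]; norm_num
      linear_combination (-energy (spd Γ s) (jet Γ s) (m + 1)) * this
    · intro x hx
      have : dt I (fun _ : ℝ × ℝ => (1 : ℝ)) (x, s) = 0 :=
        H.dt_eq_of_hasDerivWithinAt ⟨hx, hsI⟩ (hasDerivWithinAt_const _ _ _)
      rw [this, show m + 1 + (m + 1) = 2 * m + 2 by ring]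
      simp only [jet]
      ring
  exact antitoneOn_of_deriv_nonpos H.convex (H.continuousOn_wint hs1)
    (fun s hs => (hd s hs).differentiableAt.differentiableWithinAt)
    (fun s hs => by
      rw [(hd s hs).deriv]
      exact neg_nonpos.2 ((H.arcJet (interior_subset hs)).energy_nonneg _))
    H.zero_mem ht (H.nonneg t ht)

/-- The quartic remainder, divided by `k_{s^n}`, in the evolution of `∫ k_{s^n}² ds`. -/
def energyCubic (m n : ℕ) : MvPolynomial ℕ ℝ :=
  (2 : ℝ) • evolutionCubic m n - (-1 : ℝ) ^ (m + 1) • (X 0 * X (2 * m + 2) * X n)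

theorem energyCubic_mem (m n : ℕ) : energyCubic m n ∈ cubicForms (n + 2 * m + 2) := by
  refine sub_mem (Submodule.smul_mem _ _ (evolutionCubic_mem m n)) (Submodule.smul_mem _ _ ?_)
  convert X_mul_X_mul_X_mem 0 (2 * m + 2) n using 2
  ring

theorem contDiffOn_sq (H : NeumannFlow m I Γ) (n : ℕ) :
    ContDiffOn ℝ ∞ (fun q => famCurv Γ n q ^ 2) (strip I) :=
  (H.contDiffOn_famCurv n).pow 2

theorem hasDerivAt_energy (H : NeumannFlow m I Γ) (n : ℕ) (ht : t ∈ interior I) :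
    HasDerivAt (fun t => energy (spd Γ t) (jet Γ t) n)
      (-(2 * energy (spd Γ t) (jet Γ t) (n + m + 2)) +
        wint (spd Γ t) fun x =>
          jet Γ t n x * eval (fun i => jet Γ t i x) (energyCubic m n)) t := by
  have htI := interior_subset ht
  have hjet := H.arcJet htI
  refine (H.hasDerivAt_wint (H.contDiffOn_sq n) ht).congr_deriv ?_
  have h1 := hjet.wint_mul_add (n + m + 2) (m + 2) n (by ring)
  have hsign : ((-1 : ℝ) ^ (m + 1)) * (-1) ^ (m + 2) = -1 := by
    rw [pow_succ _ (m + 1), ← mul_assoc, ← mul_pow]; norm_num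
  have c1 := H.continuousOn_jet htI n
  have c2 := H.continuousOn_jet htI (n + m + 2 + (m + 2))
  have c3 := continuousOn_eval (H.continuousOn_jet htI) (energyCubic m n)
  rw [wint_congr (g := fun x =>
      (2 * (-1) ^ (m + 1)) * (jet Γ t n x * jet Γ t (n + m + 2 + (m + 2)) x) +
        jet Γ t n x * eval (fun i => jet Γ t i x) (energyCubic m n)),
    wint_add (f := fun x =>
      (2 * (-1) ^ (m + 1)) * (jet Γ t n x * jet Γ t (n + m + 2 + (m + 2)) x))
      (g := fun x => jet Γ t n x * eval (fun i => jet Γ t i x) (energyCubic m n))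
      hjet.cont (continuousOn_const.mul (c1.mul c2)) (c1.mul c3), wint_const_mul, h1]
  · linear_combination (2 * energy (spd Γ t) (jet Γ t) (n + m + 2)) * hsign
  · intro x hx
    have hp : ((x, t) : ℝ × ℝ) ∈ strip I := ⟨hx, htI⟩
    have h2 : dt I (fun q => famCurv Γ n q ^ 2) (x, t) =
        2 * famCurv Γ n (x, t) * dt I (famCurv Γ n) (x, t) :=
      H.dt_eq_of_hasDerivWithinAt hp
        (((H.hasDerivWithinAt_dt (H.contDiffOn_famCurv n) hp).pow 2).congr_deriv (by
          push_cast; ring))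
    rw [h2, H.dt_famCurv n hp, show n + m + 2 + (m + 2) = n + 2 * m + 4 by ring]
    simp only [energyCubic, map_sub, smul_eval, map_mul, eval_X, jet]
    ring

/-- The energy inequality for `∫ k_{s^n}² ds`. -/
theorem exists_deriv_energy_le (m n : ℕ) : ∃ C : ℝ, 0 < C ∧
    ∀ (I : Set ℝ) (Γ : ℝ × ℝ → Plane), NeumannFlow m I Γ → ∀ t ∈ interior I,
      deriv (fun t => energy (spd Γ t) (jet Γ t) n) t ≤
        -energy (spd Γ t) (jet Γ t) (n + m + 2) +
          C * energy (spd Γ t) (jet Γ t) 0 ^ (2 * (n + m + 2) + 1) := by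
  obtain ⟨C, hC0, hC⟩ := exists_wint_mul_eval_le_energy (N := n + m + 2) (n := n) (by ring)
    (energyCubic_mem m n)
  refine ⟨C, hC0, fun I Γ H t ht => ?_⟩
  rw [(H.hasDerivAt_energy n ht).deriv]
  have := hC _ _ (H.arcJet (interior_subset ht))
  linarith

/-- When the energy equals $M$, Poincaré applied $m+2$ times with $L\le L_0$ gives
$M\le(4L_0^2)^{m+2}E_{n+m+2}$. The condition on $K$ then forces $E_{n+m+2}>K$, so the energy is
decreasing there. -/
theorem energy_le_of_deriv_le (H : NeumannFlow m I Γ) {n : ℕ} {M K L₀ : ℝ}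
    (hL : L₀ = wint (spd Γ 0) fun _ => 1)
    (hM : energy (spd Γ 0) (jet Γ 0) n < M)
    (hd : ∀ t ∈ interior I, energy (spd Γ t) (jet Γ t) n = M →
      deriv (fun t => energy (spd Γ t) (jet Γ t) n) t ≤
        -energy (spd Γ t) (jet Γ t) (n + m + 2) + K)
    (hK : (4 * L₀ ^ 2) ^ (m + 2) * K < M) (ht : t ∈ I) :
    energy (spd Γ t) (jet Γ t) n ≤ M := by
  refine le_of_deriv_neg_at_barrier (f := fun t => energy (spd Γ t) (jet Γ t) n) H.convex H.zero_mem
    (H.continuousOn_wint (H.contDiffOn_sq n))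
    (fun s hs => (H.hasDerivAt_energy n hs).differentiableAt.hasDerivAt) hM
    (fun s hs hsM => ?_) ht (H.nonneg t ht)
  have hsI := interior_subset hs
  have hjet := H.arcJet hsI
  have h1 := hjet.energy_le_pow n (m + 2)
  have h2 : wint (spd Γ s) (fun _ => 1) ≤ L₀ := hL ▸ H.length_le hsI
  have h3 : 0 ≤ wint (spd Γ s) (fun _ => 1) := wint_nonneg hjet.pos fun _ _ => zero_le_one
  have h4 : M ≤ (4 * L₀ ^ 2) ^ (m + 2) * energy (spd Γ s) (jet Γ s) (n + (m + 2)) := by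
    rw [← hsM]
    refine h1.trans (mul_le_mul_of_nonneg_right ?_ (hjet.energy_nonneg _))
    gcongr
  have h5 : K < energy (spd Γ s) (jet Γ s) (n + (m + 2)) := by
    by_contra! hle
    have := mul_le_mul_of_nonneg_left hle (show 0 ≤ (4 * L₀ ^ 2) ^ (m + 2) by positivity)
    linarith
  have h6 := hd s hs hsM
  rw [← add_assoc] at h5
  linarith

theorem exists_energy_bound (m : ℕ) : ∃ ε : ℝ, 0 < ε ∧ ∀ n : ℕ, ∃ C : ℝ → ℝ → ℝ,
    ∀ (I : Set ℝ) (Γ : ℝ × ℝ → Plane), NeumannFlow m I Γ →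
      wint (spd Γ 0) (fun _ => 1) * energy (spd Γ 0) (jet Γ 0) 0 ≤ ε → ∀ t ∈ I,
        energy (spd Γ t) (jet Γ t) n ≤
          C (wint (spd Γ 0) fun _ => 1) (energy (spd Γ 0) (jet Γ 0) n) := by
  obtain ⟨C₀, hC₀, hdC₀⟩ := exists_deriv_energy_le m 0
  -- Chosen so that $4\varepsilon=(C_0+1)^{-1}$. For the barrier $M=2\varepsilon/L_0$ one has
  -- $4L_0^2M^2=(4\varepsilon)^2$, so $L_0$ drops out and the barrier condition reads
  -- $C_0(4\varepsilon)^{2(m+2)}<1$.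
  set ε : ℝ := (4 * (C₀ + 1))⁻¹ with hε
  have hεpos : 0 < ε := by positivity
  refine ⟨ε, hεpos, fun n => ?_⟩
  obtain ⟨C₁, hC₁, hdC₁⟩ := exists_deriv_energy_le m n
  -- Initial energy, plus the level that Poincaré attaches to the forcing $C_1M^{2N+1}$, plus $1$ to
  -- make both barrier inequalities strict.
  refine ⟨fun L E => E + (4 * L ^ 2) ^ (m + 2) *
    (C₁ * (2 * ε / L) ^ (2 * (n + m + 2) + 1)) + 1, fun I Γ H hsmall t ht => ?_⟩
  have hjet := H.arcJet H.zero_mem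
  set L₀ := wint (spd Γ 0) fun _ => 1 with hL₀
  have hLpos : 0 < L₀ := by
    simp only [hL₀, wint, one_mul]
    exact intervalIntegral.intervalIntegral_pos_of_pos_on
      (intervalIntegrable_of_continuousOn_param hjet.cont)
      (fun x hx => hjet.pos x (Ioo_subset_Icc_self hx)) (by norm_num)
  set M := 2 * ε / L₀ with hM
  have hMpos : 0 < M := by positivity
  have hbound : ∀ s ∈ I, energy (spd Γ s) (jet Γ s) 0 ≤ M := by
    intro s hs
    refine H.energy_le_of_deriv_le (K := C₀ * M ^ (2 * (0 + m + 2) + 1)) hL₀ ?_ ?_ ?_ hs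
    · rw [hM, lt_div_iff₀ hLpos]
      linarith
    · intro s hs hsM
      have := hdC₀ I Γ H s hs
      rwa [hsM] at this
    · have hy : 4 * ε = (C₀ + 1)⁻¹ := by rw [hε]; field_simp
      have hy1 : (C₀ + 1)⁻¹ ≤ 1 := inv_le_one_of_one_le₀ (by linarith)
      have e : (4 * L₀ ^ 2) ^ (m + 2) * (C₀ * M ^ (2 * (0 + m + 2) + 1)) =
          C₀ * ((4 * ε) ^ 2) ^ (m + 2) * M := by
        have e1 : (4 * ε) ^ 2 = 4 * L₀ ^ 2 * M ^ 2 := by rw [hM]; field_simp; ring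
        rw [e1, mul_pow (4 * L₀ ^ 2), show 2 * (0 + m + 2) + 1 = 2 * (m + 2) + 1 by ring,
          pow_succ M, pow_mul M]
        ring
      rw [e, hy, ← pow_mul]
      have h1 : (C₀ + 1)⁻¹ ^ (2 * (m + 2)) ≤ (C₀ + 1)⁻¹ :=
        pow_le_of_le_one (by positivity) hy1 (by omega)
      have h2 : C₀ * (C₀ + 1)⁻¹ < 1 := by
        rw [← div_eq_mul_inv, div_lt_one (by positivity)]; linarith
      have h3 : C₀ * (C₀ + 1)⁻¹ ^ (2 * (m + 2)) < 1 :=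
        (mul_le_mul_of_nonneg_left h1 hC₀.le).trans_lt h2
      nlinarith
  have hE := hjet.energy_nonneg n
  have hpos : 0 ≤ (4 * L₀ ^ 2) ^ (m + 2) * (C₁ * M ^ (2 * (n + m + 2) + 1)) := by positivity
  refine H.energy_le_of_deriv_le (K := C₁ * M ^ (2 * (n + m + 2) + 1)) hL₀
    (by linarith) (fun s hs _ => ?_) (by linarith) ht
  refine (hdC₁ I Γ H s hs).trans ?_
  have hs0 := (H.arcJet (interior_subset hs)).energy_nonneg 0
  have := hbound s (interior_subset hs)
  gcongr

end NeumannFlow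

end PolyharmonicFlow

/-! ### Translation to the original formulation. -/

namespace PolyharmonicFlow

open Set

theorem convex_timeInterval (T : EReal) : Convex ℝ (timeInterval T) := by
  refine OrdConnected.convex ⟨fun x hx y hy z hz => ⟨hx.1.trans hz.1, ?_⟩⟩
  exact (EReal.coe_le_coe_iff.2 hz.2).trans_lt hy.2

theorem nonempty_interior_timeInterval {T : EReal} (hT : 0 < T) :
    (interior (timeInterval T)).Nonempty := by
  obtain ⟨b, hb0, hbT⟩ := EReal.lt_iff_exists_real_btwn.1 hT
  have hb : 0 < b := EReal.coe_pos.1 hb0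
  have hsub : Ioo 0 b ⊆ timeInterval T := fun x hx =>
    ⟨hx.1.le, (EReal.coe_lt_coe_iff.2 hx.2).trans hbT⟩
  exact ⟨b / 2, interior_maximal hsub isOpen_Ioo ⟨by linarith, by linarith⟩⟩

section Congr

variable {c c' : ℝ → Plane}

theorem speed_congr (h : ∀ x ∈ Param, c x = c' x) {x : ℝ} (hx : x ∈ Param) :
    speed c x = speed c' x := by
  rw [speed, speed, derivWithin_congr h (h x hx)]

theorem arcDeriv_congr {E : Type*} [NormedAddCommGroup E] [NormedSpace ℝ E] {f f' : ℝ → E}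
    (h : ∀ x ∈ Param, c x = c' x) (hf : ∀ x ∈ Param, f x = f' x) {x : ℝ} (hx : x ∈ Param) :
    arcDeriv c f x = arcDeriv c' f' x := by
  rw [arcDeriv, arcDeriv, speed_congr h hx, derivWithin_congr hf (hf x hx)]

/-- The flow agrees with $\gamma_0$ at time $0$ only on `Param`; derivatives within `Param` see
nothing else. -/
theorem curvatureDeriv_congr (h : ∀ x ∈ Param, c x = c' x) (n : ℕ) {x : ℝ} (hx : x ∈ Param) :
    curvatureDeriv c n x = curvatureDeriv c' n x := by
  induction n generalizing x with
  | zero =>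
    have ht : ∀ y ∈ Param, tangent c y = tangent c' y := fun y hy => arcDeriv_congr h h hy
    change inner ℝ (arcDeriv c (tangent c) x) (normal c x) =
      inner ℝ (arcDeriv c' (tangent c') x) (normal c' x)
    rw [arcDeriv_congr h ht hx, normal, normal, ht x hx]
  | succ n ih =>
    rw [curvatureDeriv_succ, curvatureDeriv_succ]
    exact arcDeriv_congr h (fun y hy => ih hy) hx

theorem arcIntegral_congr {f f' : ℝ → ℝ} (h : ∀ x ∈ Param, c x = c' x)
    (hf : ∀ x ∈ Param, f x = f' x) : arcIntegral c f = arcIntegral c' f' :=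
  intervalIntegral.integral_congr fun x hx => by
    rw [uIcc_param] at hx
    simp only [hf x hx, speed_congr h hx]

end Congr

theorem wint_spd (γ : ℝ → ℝ → Plane) (t : ℝ) (f : ℝ → ℝ) :
    wint (NeumannFlow.spd (fun p => γ p.1 p.2) t) f = arcIntegral (fun x => γ x t) f := rfl

theorem energy_famCurv (γ : ℝ → ℝ → Plane) (n : ℕ) (t : ℝ) :
    ArcJet.energy (NeumannFlow.spd (fun p => γ p.1 p.2) t)
      (NeumannFlow.jet (fun p => γ p.1 p.2) t) n = curvatureEnergy (fun x => γ x t) n := by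
  simp only [ArcJet.energy, NeumannFlow.jet, famCurv_eq]
  exact wint_spd γ t _

theorem IsPolyharmonicFlow.neumannFlow {m : ℕ} {a d : ℝ} {γ₀ : ℝ → Plane} {T : EReal}
    {γ : ℝ → ℝ → Plane} (h : IsPolyharmonicFlow m a d γ₀ T γ) (hT : 0 < T)
    (hω : windingNumber γ₀ = 0) : NeumannFlow m (timeInterval T) fun p => γ p.1 p.2 where
  convex := convex_timeInterval T
  nonempty := nonempty_interior_timeInterval hT
  smooth := h.smooth
  regular p hp := h.regular p.2 hp.2 p.1 hp.1
  zero_mem := ⟨le_rfl, hT⟩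
  nonneg _ ht := ht.1
  evolution q hq := by
    rw [famCurv_eq, famNormal_eq]
    exact h.evolution q.2 hq.2 q.1 hq.1
  orthogonal := by
    rintro x (rfl | rfl) t ht
    · exact (h.boundary t ht).left_orthogonal
    · exact (h.boundary t ht).right_orthogonal
  odd := by
    rintro x (rfl | rfl) t ht i hi
    · rw [famCurv_eq]
      exact (h.boundary t ht).left_odd i hi
    · rw [famCurv_eq]
      exact (h.boundary t ht).right_odd i hi
  winding := by
    rw [windingNumber] at hω
    have h1 := (mul_eq_zero.1 hω).resolve_left (inv_ne_zero (by positivity))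
    refine Eq.trans ?_ h1
    rw [wint_spd]
    refine arcIntegral_congr h.initial fun x hx => ?_
    rw [famCurv_eq]
    exact curvatureDeriv_congr h.initial 0 hx

end PolyharmonicFlow
end

open PolyharmonicFlow in
theorem corollary3p3 (m : ℕ) :
    ∃ ε : ℝ, 0 < ε ∧ ∀ ℓ : ℕ, ∃ C : ℝ → ℝ → ℝ,
      ∀ (a d₀ : ℝ) (γ₀ : ℝ → Plane), 0 < d₀ →
        IsSmoothImmersed γ₀ → HasNeumannBoundary m a d₀ γ₀ → windingNumber γ₀ = 0 →
        length γ₀ * curvatureEnergy γ₀ 0 ≤ ε →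
        ∀ (T : EReal) (γ : ℝ → ℝ → Plane), 0 < T → IsPolyharmonicFlow m a d₀ γ₀ T γ →
          ∀ t ∈ timeInterval T,
            curvatureEnergy (fun x => γ x t) ℓ ≤
              C (length γ₀) (curvatureEnergy γ₀ ℓ) := by
  obtain ⟨ε, hε, h⟩ := NeumannFlow.exists_energy_bound m
  refine ⟨ε, hε, fun ℓ => ?_⟩
  obtain ⟨C, hC⟩ := h ℓ
  refine ⟨C, fun a d₀ γ₀ _ _ _ hω hsmall T γ hT hγ t ht => ?_⟩
  have hL : wint (NeumannFlow.spd (fun p => γ p.1 p.2) 0) (fun _ => 1) = length γ₀ := by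
    rw [wint_spd]
    exact arcIntegral_congr hγ.initial fun _ _ => rfl
  have hE : ∀ n, curvatureEnergy (fun x => γ x 0) n = curvatureEnergy γ₀ n := fun n =>
    arcIntegral_congr hγ.initial fun x hx => by rw [curvatureDeriv_congr hγ.initial n hx]
  have key := hC _ _ (hγ.neumannFlow hT hω)
  simp only [energy_famCurv, hL, hE] at key
  exact key hsmall t ht
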